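/- **Proposition (Bretagnolle inequality).** Let $N\ge 1$ and let $X_1,\dots,X_N$ be $N$ independent real random variables on a probability space, with respective cumulative distribution functions $J_1,\dots,J_N$. Let $K_1,\dots,K_N:\mathbb R\to\mathbb R$ be functions such that $J_i(x)\le K_i(x)$ for all $i\in\{1,\dots,N\}$ and all $x\in\mathbb R$, and let $\bar K(x)=\frac1N\sum_{i=1}^N K_i(x)$. Then, for all $\lambda\ge 0$, $$\mathbb P\left(\sqrt N\,\sup_{t\in\mathbb R}\left(\frac1N\sum_{i=1}^N \mathbf 1\{X_i\le t\}-\bar K(t)\right)>\lambda\right)\le e\cdot\exp(-2\lambda^2).$$ -/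

import Mathlib

open MeasureTheory ProbabilityTheory

/-- The empirical cumulative distribution function of a real sample `x` of size `N`:
`t ↦ (1 / N) * #{i | x i ≤ t}`, written as a mean of indicators. -/
noncomputable def empiricalCDF {N : ℕ} (x : Fin N → ℝ) (t : ℝ) : ℝ :=
  (1 / (N : ℝ)) * ∑ i, Set.indicator (Set.Iic t) (fun _ => (1 : ℝ)) (x i)

/-- The pointwise arithmetic mean `t ↦ (1 / N) * ∑ i, K i t` of `N` real functions. -/
noncomputable def meanFun {N : ℕ} (K : Fin N → ℝ → ℝ) (t : ℝ) : ℝ :=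
  (1 / (N : ℝ)) * ∑ i, K i t

/-!
The proof compares the `N` independent points with `N` independent points that all follow the mean
`q` of their distributions, proves an exponential bound for the latter by a mixture of likelihood
ratios, and averages that bound over consecutive levels. Put `c = √N λ`. By monotonicity and right
continuity it is enough to consider finitely many levels; the points then fall into finitely many
cells, and the event says that some cumulative count exceeds its mean `N v` by `c`.

*Comparison.* Fix integer levels and let `T` be the positive part of the largest excess of the
counts over them. As a function of the positions `a`, `b` of two of the points,
`T = ρ + u a + u b + g a * g b` (`exists_sup_two_points_eq`). Hence replacing two of the
distributions by their average changes the mean of `T` by a square and can only increase it. A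
compactness argument shows that the mean of `T` is largest when all distributions equal `q`
(`productMean_excess_le_mean`). With levels `z` below the critical ones, Markov's inequality
bounds the probability of an excess `c` by `1 / z` times the sum of the probabilities, for
identically distributed points, of the excesses `c - z + 1, …, c - z + N`
(`sum_crossing_le_sum_crossingWeight`).

*Identically distributed points.* The likelihood ratio of the counts of `N + m` points against
those of `N` points is a supermartingale. If `n` points remain when an excess `c` occurs, it has
grown by the factor `exp (logGain N n y m)`, where `y ≥ n + c` is `N` times the remaining mass.
Stirling-type estimates show that for each position some `m` makes `logGain` at least
`2 c (c - 1) / N - log (1 - c / N) / 2` (`exists_le_logGain`). The suitable `m` depends on the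
position, but for `y = n + c` the function `logGain` is convex in `1 / y`, so a minimax argument
yields a mixture over `m` that serves all positions at once. This gives the bound
`exp (-2 c (c - 1) / N) * √(1 - c / N)` (`crossingWeight_le`).

*The constant.* Summing this bound over the excesses above leaves essentially
`exp (-2 c² / N) * exp (θ z) / (θ z)` with `θ ≈ 4 c / N`, and the choice `z ≈ 1 / θ` gives the
factor `e` (`exists_average_le`). A single point is treated separately (`crossingWeight_one_le`).
-/

/-! ### Stirling-type increments of the logarithm -/

theorem Real.log_le_half_sub_inv {x : ℝ} (hx : 1 ≤ x) : Real.log x ≤ (x - x⁻¹) / 2 := by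
  have h := Real.self_le_sinh_iff.2 (Real.log_nonneg hx)
  rwa [Real.sinh_log (by linarith)] at h

/-- The increment `(x + 1/2) log (1 + 1/x)` of Stirling's approximation to `log x!`. -/
noncomputable def stirlingStep (x : ℝ) : ℝ := (x + 1 / 2) * (Real.log (x + 1) - Real.log x)

theorem stirlingStep_antitoneOn : AntitoneOn stirlingStep (Set.Ioi 0) := by
  have hd : ∀ x ∈ Set.Ioi (0 : ℝ), HasDerivAt stirlingStep
      (1 * (Real.log (x + 1) - Real.log x) + (x + 1 / 2) * (1 / (x + 1) - 1 / x)) x := by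
    intro x hx
    have hx : 0 < x := hx
    have h1 : HasDerivAt (fun x : ℝ => x + 1 / 2) 1 x := (hasDerivAt_id x).add_const _
    have h2 : HasDerivAt (fun x : ℝ => Real.log (x + 1)) (1 / (x + 1)) x :=
      ((hasDerivAt_id x).add_const (1 : ℝ)).log (by simp; linarith)
    have h3 : HasDerivAt (fun x : ℝ => Real.log x) (1 / x) x := (hasDerivAt_id x).log hx.ne'
    exact h1.mul (h2.sub h3)
  apply antitoneOn_of_deriv_nonpos (convex_Ioi 0)
  · exact fun x hx => (hd x hx).continuousAt.continuousWithinAt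
  · rw [interior_Ioi]
    exact fun x hx => (hd x hx).differentiableAt.differentiableWithinAt
  · rw [interior_Ioi]
    intro x hx
    rw [(hd x hx).deriv]
    have hx : 0 < x := hx
    have h := Real.log_le_half_sub_inv (x := (x + 1) / x) (by rw [le_div_iff₀ hx]; linarith)
    rw [Real.log_div (by linarith) hx.ne'] at h
    have e : ((x + 1) / x - ((x + 1) / x)⁻¹) / 2 = -((x + 1 / 2) * (1 / (x + 1) - 1 / x)) := by
      have : x + 1 ≠ 0 := by linarith
      field_simp
      ring
    linarith

/-! ### The exponent of the tilted bound -/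

/-- With `N` points, `n` of which still lie beyond the current level, and rescaled remaining
length `y`, this is the logarithm of the ratio between the current and the initial value of the
supermartingale attached to `m` additional points; `a` plays the role of `n`. -/
noncomputable def logGain (N a y : ℝ) (m : ℕ) : ℝ :=
  ∑ l ∈ Finset.range m,
    (Real.log y + Real.log (N + (l + 1)) - Real.log N - Real.log (a + (l + 1)))

/-- The lower bound for `logGain` obtained from the trapezoidal rule, with the best `m`. -/
noncomputable def trapezoidGain (N a y : ℝ) : ℝ :=
  -(a + 1 / 2) * (Real.log y + Real.log (N + 1) - Real.log N - Real.log (a + 1)) +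
    (N - a) * (Real.log N + Real.log (N - a) - Real.log (N + 1) - Real.log (N - y))

/-- The error of the trapezoidal rule for `∑ log (x + l)`, up to terms depending on `x` only,
increases with `x`: its increments in `m` are values of the antitone function `stirlingStep`. -/
theorem trapezoid_defect_mono {a N : ℝ} (ha : 0 ≤ a) (haN : a ≤ N) (m : ℕ) :
    (∑ l ∈ Finset.range (m + 1), Real.log (a + (l + 1))) - (m + 1) * Real.log (a + (m + 1)) -
        (a + 1 / 2) * (Real.log (a + (m + 1)) - Real.log (a + 1)) ≤
      (∑ l ∈ Finset.range (m + 1), Real.log (N + (l + 1))) - (m + 1) * Real.log (N + (m + 1)) -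
        (N + 1 / 2) * (Real.log (N + (m + 1)) - Real.log (N + 1)) := by
  induction m with
  | zero => simp
  | succ m ih =>
    have hm : (0 : ℝ) ≤ m := m.cast_nonneg
    have h := stirlingStep_antitoneOn (a := a + (m + 1)) (b := N + (m + 1))
      (by simp only [Set.mem_Ioi]; linarith) (by simp only [Set.mem_Ioi]; linarith) (by linarith)
    rw [Finset.sum_range_succ, Finset.sum_range_succ _ (m + 1)]
    unfold stirlingStep at h
    push_cast
    rw [show a + ((m : ℝ) + 1 + 1) = a + (m + 1) + 1 by ring,
      show N + ((m : ℝ) + 1 + 1) = N + (m + 1) + 1 by ring]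
    linarith

/-- The comparison at the knots, where the last summand of `logGain` vanishes. -/
theorem trapezoidGain_le_logGain_knot {a N : ℝ} (ha : 0 ≤ a) (haN : a < N) (m : ℕ) :
    trapezoidGain N a (N * (a + (m + 1)) / (N + (m + 1))) ≤
      logGain N a (N * (a + (m + 1)) / (N + (m + 1))) (m + 1) := by
  have hm : (0 : ℝ) ≤ m := m.cast_nonneg
  have hN : 0 < N := by linarith
  have h1 : 0 < a + (m + 1) := by linarith
  have h2 : 0 < N + (m + 1) := by linarith
  have h := trapezoid_defect_mono ha haN.le m
  have e1 : Real.log (N * (a + (m + 1)) / (N + (m + 1))) =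
      Real.log N + Real.log (a + (m + 1)) - Real.log (N + (m + 1)) := by
    rw [Real.log_div (by positivity) h2.ne', Real.log_mul hN.ne' h1.ne']
  have e2 : Real.log (N - N * (a + (m + 1)) / (N + (m + 1))) =
      Real.log N + Real.log (N - a) - Real.log (N + (m + 1)) := by
    rw [show N - N * (a + (m + 1)) / (N + (m + 1)) = N * (N - a) / (N + (m + 1)) by
      field_simp; ring, Real.log_div (by nlinarith) h2.ne', Real.log_mul hN.ne' (by linarith)]
  unfold trapezoidGain logGain
  rw [e1, e2]
  simp only [Finset.sum_add_distrib, Finset.sum_sub_distrib, Finset.sum_const, Finset.card_range,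
    nsmul_eq_mul]
  push_cast
  linarith

/-- Between two consecutive knots the difference of the two sides is concave in `y`, so that the
comparison at the knots suffices. -/
theorem trapezoidGain_le_logGain {a y N : ℝ} (ha : 0 ≤ a) (hy : y < N) (m : ℕ)
    (h1 : N * (a + (m + 1)) / (N + (m + 1)) ≤ y) (h2 : y ≤ N * (a + (m + 2)) / (N + (m + 2)))
    (hay : a < y) :
    trapezoidGain N a y ≤ logGain N a y (m + 1) := by
  have hm : (0 : ℝ) ≤ m := m.cast_nonneg
  have haN : a < N := by linarith
  have hN : 0 < N := by linarith
  have hconc : ConcaveOn ℝ (Set.Ioo 0 N) (fun x => logGain N a x (m + 1) - trapezoidGain N a x) := by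
    have c1 : ConcaveOn ℝ (Set.Ioo 0 N) (fun x => ((m + 1) + a + 1 / 2) * Real.log x) := by
      have := (strictConcaveOn_log_Ioi.concaveOn.subset
        (fun x hx => hx.1 : Set.Ioo 0 N ⊆ Set.Ioi 0) (convex_Ioo 0 N)).smul
        (c := ((m + 1) + a + 1 / 2 : ℝ)) (by positivity)
      simpa [smul_eq_mul] using this
    have c2 : ConcaveOn ℝ (Set.Ioo 0 N) (fun x => (N - a) * Real.log (N - x)) := by
      have h := strictConcaveOn_log_Ioi.concaveOn.comp_affineMap
        (AffineMap.const ℝ ℝ N - AffineMap.id ℝ ℝ)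
      have h' : ConcaveOn ℝ (Set.Ioo 0 N) (fun x => Real.log (N - x)) := by
        refine h.subset ?_ (convex_Ioo 0 N)
        intro x hx
        simpa using hx.2
      have := h'.smul (c := N - a) (by linarith)
      simpa [smul_eq_mul] using this
    have c3 := (c1.add c2).add (concaveOn_const
      (logGain N a 1 (m + 1) + (a + 1 / 2) * (Real.log (N + 1) - Real.log N - Real.log (a + 1)) -
        (N - a) * (Real.log N + Real.log (N - a) - Real.log (N + 1))) (convex_Ioo (0 : ℝ) N))
    refine c3.congr fun x hx => ?_
    unfold logGain trapezoidGain
    simp only [Pi.add_apply, Finset.sum_add_distrib, Finset.sum_sub_distrib, Finset.sum_const,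
      Finset.card_range, nsmul_eq_mul, Real.log_one]
    push_cast
    ring
  have k1 : N * (a + (m + 1)) / (N + (m + 1)) ∈ Set.Ioo 0 N := by
    constructor
    · positivity
    · rw [div_lt_iff₀ (by positivity)]; nlinarith
  have k2 : N * (a + (m + 2)) / (N + (m + 2)) ∈ Set.Ioo 0 N := by
    constructor
    · positivity
    · rw [div_lt_iff₀ (by positivity)]; nlinarith
  have h := hconc.min_le_of_mem_Icc k1 k2 ⟨h1, h2⟩
  have b1 := trapezoidGain_le_logGain_knot ha haN m
  have b2 := trapezoidGain_le_logGain_knot ha haN (m + 1)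
  -- the summand with index `m + 1` vanishes at the right end point
  have b3 : logGain N a (N * (a + (m + 2)) / (N + (m + 2))) (m + 1 + 1) =
      logGain N a (N * (a + (m + 2)) / (N + (m + 2))) (m + 1) := by
    unfold logGain
    rw [Finset.sum_range_succ _ (m + 1), add_eq_left]
    have h1 : 0 < a + (m + 2) := by linarith
    have h2 : 0 < N + (m + 2) := by linarith
    push_cast
    rw [Real.log_div (by positivity) h2.ne', Real.log_mul hN.ne' h1.ne',
      show a + ((m : ℝ) + 1 + 1) = a + (m + 2) by ring,
      show N + ((m : ℝ) + 1 + 1) = N + (m + 2) by ring]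
    ring
  push_cast at b2
  rw [show a + ((m : ℝ) + 1 + 1) = a + (m + 2) by ring,
      show N + ((m : ℝ) + 1 + 1) = N + (m + 2) by ring] at b2
  rcases min_le_iff.1 h with h | h
  · linarith
  · linarith

/-- The derivative in `c` of the difference of the two sides is
`(2 c - 1) (N - 2 y)² / (2 N y (N - y))`, where `y = a + c`. -/
theorem le_trapezoidGain {a c N : ℝ} (ha : 0 ≤ a) (hc : 1 ≤ c) (hN : a + c < N) :
    2 * c * (c - 1) / N + 1 / 2 * (Real.log (N - a) - Real.log (N - a - c)) ≤
      trapezoidGain N a (a + c) := by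
  have hN0 : 0 < N := by linarith
  set D : ℝ → ℝ := fun c => trapezoidGain N a (a + c) -
    (2 * c * (c - 1) / N + 1 / 2 * (Real.log (N - a) - Real.log (N - a - c))) with hD
  have hder : ∀ x ∈ Set.Icc 1 c, HasDerivAt D
      ((-(a + 1 / 2) * (1 / (a + x)) + (N - a) * (-(-1 / (N - (a + x))))) -
        ((2 * (x - 1) + 2 * x * 1) / N + 1 / 2 * (-(-1 / (N - a - x))))) x := by
    intro x hx
    have hx1 : 1 ≤ x := hx.1
    have hx2 : x ≤ c := hx.2
    have i1 : HasDerivAt (fun c : ℝ => a + c) 1 x := (hasDerivAt_id x).const_add a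
    have d1 : HasDerivAt (fun c : ℝ => Real.log (a + c)) (1 / (a + x)) x := i1.log (by linarith)
    have d2 : HasDerivAt (fun c : ℝ => Real.log (N - (a + c))) (-1 / (N - (a + x))) x :=
      (i1.const_sub N).log (by linarith)
    have d3 : HasDerivAt (fun c : ℝ => Real.log (N - a - c)) (-1 / (N - a - x)) x :=
      ((hasDerivAt_id x).const_sub (N - a)).log (by simp; linarith)
    have d4 : HasDerivAt (fun c : ℝ => 2 * c * (c - 1) / N) ((2 * (x - 1) + 2 * x * 1) / N) x := by
      have e1 : HasDerivAt (fun c : ℝ => 2 * c) 2 x := by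
        simpa using (hasDerivAt_id x).const_mul (2 : ℝ)
      exact (e1.mul ((hasDerivAt_id x).sub_const 1)).div_const N
    have := ((((d1.add_const (Real.log (N + 1))).sub_const (Real.log N)).sub_const
      (Real.log (a + 1))).const_mul (-(a + 1 / 2))).add
      ((d2.const_sub (Real.log N + Real.log (N - a) - Real.log (N + 1))).const_mul (N - a))
    exact this.sub (d4.add ((d3.const_sub (Real.log (N - a))).const_mul (1 / 2)))
  have hmono : MonotoneOn D (Set.Icc 1 c) := by
    apply monotoneOn_of_deriv_nonneg (convex_Icc 1 c)
    · exact fun x hx => (hder x hx).continuousAt.continuousWithinAt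
    · exact fun x hx => (hder x (interior_subset hx)).differentiableAt.differentiableWithinAt
    · intro x hx
      have hx := interior_subset hx
      rw [(hder x hx).deriv]
      have hx1 : 1 ≤ x := hx.1
      have p1 : 0 < a + x := by linarith
      have p2 : 0 < N - (a + x) := by linarith [hx.2]
      have e : ((-(a + 1 / 2) * (1 / (a + x)) + (N - a) * (-(-1 / (N - (a + x))))) -
        ((2 * (x - 1) + 2 * x * 1) / N + 1 / 2 * (-(-1 / (N - a - x))))) =
          (2 * x - 1) * (N - 2 * (a + x)) ^ 2 / (2 * N * (a + x) * (N - (a + x))) := by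
        rw [show N - a - x = N - (a + x) by ring]
        field_simp
        ring
      rw [e]
      have : 0 ≤ 2 * x - 1 := by linarith
      positivity
  have h := hmono (Set.left_mem_Icc.2 hc) (Set.right_mem_Icc.2 hc) hc
  have h0 : 0 ≤ D 1 := by
    have hs := stirlingStep_antitoneOn (a := N - a - 1) (b := N)
      (by simp only [Set.mem_Ioi]; linarith) hN0 (by linarith)
    simp only [stirlingStep, hD, trapezoidGain] at hs ⊢
    rw [show N - a - 1 + 1 = N - a by ring] at hs
    rw [show N - (a + 1) = N - a - 1 by ring]
    simp only [sub_self, mul_zero, zero_div, zero_add]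
    linarith
  simp only [hD] at h h0
  linarith

/-- For every remaining number of points some number of additional points gives the right
exponent. The best choice is `⌊N c / (N - y)⌋`, the number of positive summands. -/
theorem exists_le_logGain {a c N : ℝ} (ha : 0 ≤ a) (hc : 1 ≤ c) (hN : a + c < N) :
    2 * c * (c - 1) / N - 1 / 2 * Real.log (1 - c / N) ≤
      logGain N a (a + c) ⌊N * c / (N - (a + c))⌋₊ := by
  have hN0 : 0 < N := by linarith
  have hT : 0 < N - (a + c) := by linarith
  set L := N * c / (N - (a + c)) with hL
  have hL1 : 1 ≤ L := by
    rw [hL, le_div_iff₀ hT]; nlinarith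
  obtain ⟨m, hm⟩ : ∃ m, ⌊L⌋₊ = m + 1 := Nat.exists_eq_succ_of_ne_zero
    (Nat.floor_pos.2 hL1).ne'
  have hm0 : (0 : ℝ) ≤ m := m.cast_nonneg
  have f1 : (m : ℝ) + 1 ≤ L := by
    have := Nat.floor_le (show 0 ≤ L by linarith)
    rw [hm] at this; exact_mod_cast this
  have f2 : L ≤ (m : ℝ) + 2 := by
    have := (Nat.lt_floor_add_one L).le
    rw [hm] at this; push_cast at this; linarith
  rw [hL] at f1 f2
  rw [le_div_iff₀ hT] at f1
  rw [div_le_iff₀ hT] at f2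
  rw [hm]
  have t := trapezoidGain_le_logGain (a := a) (y := a + c) (N := N) ha hN m
    (by rw [div_le_iff₀ (by linarith)]; nlinarith)
    (by rw [le_div_iff₀ (by linarith)]; nlinarith) (by linarith)
  have u := le_trapezoidGain ha hc hN
  have v : - Real.log (1 - c / N) ≤ Real.log (N - a) - Real.log (N - a - c) := by
    rw [← Real.log_div (by linarith) (by linarith), ← Real.log_inv]
    have : 0 < 1 - c / N := by
      rw [sub_pos, div_lt_one hN0]; linarith
    apply Real.log_le_log (by positivity)
    rw [show 1 - c / N = (N - c) / N by field_simp, inv_div,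
      div_le_div_iff₀ (by linarith) (by linarith)]
    nlinarith
  linarith

/-! ### A finite minimax principle -/

/-- If the maximum of finitely many convex functions is everywhere at least `F`, then so is one of
their convex combinations. -/
theorem exists_weights_le_sum_of_convexOn {ι E : Type*} [Fintype ι] [AddCommGroup E] [Module ℝ E]
    {S : Set E} {f : ι → E → ℝ} {F : ℝ} (hS : S.Nonempty) (hf : ∀ i, ConvexOn ℝ S (f i))
    (h : ∀ s ∈ S, ∃ i, F ≤ f i s) :
    ∃ w : ι → ℝ, (∀ i, 0 ≤ w i) ∧ ∑ i, w i = 1 ∧ ∀ s ∈ S, F ≤ ∑ i, w i * f i s := by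
  classical
  -- separate the open orthant below `(F, …, F)` from the points above the graph of `f`
  obtain ⟨g, u, hA, hB⟩ := geometric_hahn_banach_open
    (s := Set.univ.pi fun _ : ι => Set.Iio F) (t := {x : ι → ℝ | ∃ s ∈ S, ∀ i, f i s ≤ x i})
    (convex_pi fun _ _ => convex_Iio F)
    (isOpen_set_pi Set.finite_univ fun _ _ => isOpen_Iio)
    (by
      rintro x ⟨s, hs, hx⟩ y ⟨t, ht, hy⟩ a b ha hb hab
      refine ⟨a • s + b • t, (hf (h s hs).choose).1 hs ht ha hb hab, fun i => ?_⟩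
      refine ((hf i).2 hs ht ha hb hab).trans ?_
      simp only [Pi.add_apply, Pi.smul_apply, smul_eq_mul]
      exact add_le_add (mul_le_mul_of_nonneg_left (hx i) ha)
        (mul_le_mul_of_nonneg_left (hy i) hb))
    (by
      rw [Set.disjoint_left]
      rintro x hx ⟨s, hs, hxs⟩
      obtain ⟨i, hi⟩ := h s hs
      have := hx i (Set.mem_univ i)
      simp only [Set.mem_Iio] at this
      linarith [hxs i])
  set v : ι → ℝ := fun i => g (Pi.single i 1) with hv
  have hg : ∀ x : ι → ℝ, g x = ∑ i, v i * x i := by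
    intro x
    conv_lhs => rw [← Finset.univ_sum_single x]
    rw [map_sum]
    refine Finset.sum_congr rfl fun i _ => ?_
    rw [show Pi.single i (x i) = x i • (Pi.single i (1 : ℝ) : ι → ℝ) by
      rw [← Pi.single_smul, smul_eq_mul, mul_one], map_smul, smul_eq_mul, mul_comm]
  obtain ⟨s₀, hs₀⟩ := hS
  have hb : ∀ s ∈ S, u ≤ ∑ i, v i * f i s := fun s hs => by
    rw [← hg]; exact hB _ ⟨s, hs, fun _ => le_rfl⟩
  have hv0 : ∀ i, 0 ≤ v i := by
    intro i
    by_contra hi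
    push Not at hi
    set t := (u - g (fun j => f j s₀) - 1) / v i
    have ht : 0 ≤ t := div_nonneg_of_nonpos
      (by linarith [hB (fun j => f j s₀) ⟨s₀, hs₀, fun _ => le_rfl⟩]) hi.le
    have := hB ((fun j => f j s₀) + t • Pi.single i 1) ⟨s₀, hs₀, fun j => by
      by_cases hj : j = i
      · subst hj; simp [ht]
      · simp [hj]⟩
    rw [map_add, map_smul, smul_eq_mul] at this
    have e : t * g (Pi.single i 1) = u - g (fun j => f j s₀) - 1 := div_mul_cancel₀ _ hi.ne
    linarith
  have hFu : F * ∑ i, v i ≤ u := by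
    refine le_of_forall_pos_le_add fun ε hε => ?_
    rcases (Finset.sum_nonneg fun i _ => hv0 i : 0 ≤ ∑ i, v i).eq_or_lt with h0 | h0
    · have := hA (fun _ => F - 1) (fun i _ => by simp)
      rw [hg, ← Finset.sum_mul, ← h0] at this
      rw [← h0]; linarith
    · have := hA (fun _ => F - ε / ∑ i, v i) (fun i _ => by
        simp only [Set.mem_Iio]; linarith [div_pos hε h0])
      rw [hg, ← Finset.sum_mul, mul_sub, mul_div_cancel₀ _ h0.ne'] at this
      linarith
  have hpos : 0 < ∑ i, v i := by
    refine (Finset.sum_nonneg fun i _ => hv0 i).lt_of_ne fun h0 => ?_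
    have hz : ∀ i, v i = 0 := fun i =>
      (Finset.sum_eq_zero_iff_of_nonneg fun i _ => hv0 i).1 h0.symm i (Finset.mem_univ i)
    have h1 := hA (fun _ => F - 1) (fun i _ => by simp)
    have h2 := hb s₀ hs₀
    rw [hg] at h1
    simp only [hz, zero_mul, Finset.sum_const_zero] at h1 h2
    linarith
  refine ⟨fun i => v i / ∑ j, v j, fun i => div_nonneg (hv0 i) hpos.le, ?_, fun s hs => ?_⟩
  · rw [← Finset.sum_div, div_self hpos.ne']
  · have := hb s hs
    simp only [div_mul_eq_mul_div]
    rw [← Finset.sum_div, le_div_iff₀ hpos]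
    linarith

/-! ### Level crossings of an empirical distribution with finitely many cells -/

/-- The number of points of the configuration `x` lying in the cells up to `l`. -/
def levelCount {ι K : Type*} [Fintype ι] [LinearOrder K] (x : ι → K) (l : K) : ℕ :=
  (Finset.univ.filter fun i => x i ≤ l).card

theorem levelCount_le {ι K : Type*} [Fintype ι] [LinearOrder K] (x : ι → K) (l : K) :
    levelCount x l ≤ Fintype.card ι := Finset.card_filter_le _ _

/-- The configuration whose points in `T` lie in the first cell, the others being placed in the
later cells by `y`. -/
def glueZero {ι : Type*} [DecidableEq ι] {M : ℕ} (T : Finset ι) (y : {i // i ∉ T} → Fin M) :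
    ι → Fin (M + 1) :=
  fun i => if h : i ∈ T then 0 else (y ⟨i, h⟩).succ

theorem sum_eq_sum_glueZero {ι : Type*} [Fintype ι] [DecidableEq ι] {M : ℕ}
    (f : (ι → Fin (M + 1)) → ℝ) :
    ∑ x, f x = ∑ T : Finset ι, ∑ y : {i // i ∉ T} → Fin M, f (glueZero T y) := by
  rw [← Finset.sum_fiberwise Finset.univ
    (fun x : ι → Fin (M + 1) => Finset.univ.filter fun i => x i = 0) f]
  refine Finset.sum_congr rfl fun T _ => ?_
  symm
  refine Finset.sum_bij (fun y _ => glueZero T y) (fun y _ => ?_) (fun y _ z _ h => ?_)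
    (fun x hx => ?_) (fun _ _ => rfl)
  · simp only [Finset.mem_filter, Finset.mem_univ, true_and]
    ext i
    by_cases hi : i ∈ T <;> simp [glueZero, hi, Fin.succ_ne_zero]
  · funext ⟨i, hi⟩
    have := congrFun h i
    simpa [glueZero, hi] using this
  · have hx : (Finset.univ.filter fun i => x i = 0) = T := by simpa using hx
    have hx' : ∀ i, i ∉ T → x i ≠ 0 := fun i hi h0 => hi (by rw [← hx]; simpa using h0)
    refine ⟨fun i => (x i).pred (hx' i i.2), Finset.mem_univ _, ?_⟩
    funext i
    by_cases hi : i ∈ T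
    · have : x i = 0 := by rw [← hx] at hi; simpa using hi
      simp [glueZero, hi, this]
    · simp [glueZero, hi]

theorem prod_glueZero {ι : Type*} [Fintype ι] [DecidableEq ι] {M : ℕ} (q : Fin (M + 1) → ℝ)
    (T : Finset ι) (y : {i // i ∉ T} → Fin M) :
    ∏ i, q (glueZero T y i) = q 0 ^ T.card * ∏ i, q (y i).succ := by
  rw [← Finset.prod_mul_prod_compl T, ← Finset.prod_const]
  congr 1
  · exact Finset.prod_congr rfl fun i hi => by simp [glueZero, hi]
  · rw [Finset.prod_subtype (p := fun i => i ∉ T) Tᶜ (by simp)]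
    exact Finset.prod_congr rfl fun i _ => by simp [glueZero, i.2]

theorem levelCount_glueZero_zero {ι : Type*} [Fintype ι] [DecidableEq ι] {M : ℕ}
    (T : Finset ι) (y : {i // i ∉ T} → Fin M) : levelCount (glueZero T y) 0 = T.card := by
  unfold levelCount
  congr 1
  ext i
  by_cases hi : i ∈ T <;> simp [glueZero, hi, Fin.succ_ne_zero]

theorem levelCount_glueZero_succ {ι : Type*} [Fintype ι] [DecidableEq ι] {M : ℕ}
    (T : Finset ι) (y : {i // i ∉ T} → Fin M) (l : Fin M) :
    levelCount (glueZero T y) l.succ = T.card + levelCount y l := by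
  unfold levelCount
  have h1 : (Finset.univ.filter fun i => glueZero T y i ≤ l.succ) =
      T ∪ (Finset.univ.filter fun i => y i ≤ l).map (Function.Embedding.subtype fun i => i ∉ T) := by
    ext i
    rw [Finset.mem_filter, Finset.mem_union]
    by_cases hi : i ∈ T <;> simp [glueZero, hi]
  rw [h1, Finset.card_union_of_disjoint, Finset.card_map]
  rw [Finset.disjoint_left]
  intro i hi h
  simp only [Finset.mem_map, Function.Embedding.coe_subtype] at h
  obtain ⟨j, _, rfl⟩ := h
  exact j.2 hi

open Classical in
/-- The maximal inequality for a nonnegative supermartingale `H n A`, where `n` is the number of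
points still to come and `A` the total weight of the remaining cells. The relation `cr l k'` says
that `k'` points up to the cell `l` count as a crossing, and `k` is the number of points already
found in earlier cells. The cells are peeled off one at a time. -/
theorem crossing_sum_le_of_supermartingale (N : ℕ) (H : ℕ → ℝ → ℝ)
    (hH0 : ∀ n A, 0 ≤ A → 0 ≤ H n A)
    (hstep : ∀ n a A, 0 ≤ a → 0 ≤ A →
      ∑ j ∈ Finset.range (n + 1), (n.choose j : ℝ) * (a ^ j * H (n - j) A) ≤ H n (a + A))
    (M : ℕ) : ∀ (q : Fin M → ℝ) (_ : ∀ l, 0 ≤ q l) (cr : Fin M → ℕ → Prop) (k : ℕ)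
    {ι : Type} [Fintype ι] [DecidableEq ι] (_ : k + Fintype.card ι = N)
    (_ : ∀ l k' n', k' + n' = N → cr l k' →
      (∑ l' ∈ Finset.Ioi l, q l') ^ n' ≤ H n' (∑ l' ∈ Finset.Ioi l, q l')),
    ∑ x : ι → Fin M, (∏ i, q (x i)) * (if ∃ l, cr l (k + levelCount x l) then 1 else 0) ≤
      H (Fintype.card ι) (∑ l, q l) := by
  induction M with
  | zero =>
    intro q _ cr k ι _ _ _ _
    simpa using hH0 _ _ le_rfl
  | succ M ih =>
    intro q hq cr k ι _ _ hk hcr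
    have hIoi : ∀ l : Fin M, ∑ l' ∈ Finset.Ioi l.succ, q l' = ∑ l' ∈ Finset.Ioi l, q l'.succ := by
      intro l
      rw [← Fin.map_succEmb_Ioi, Finset.sum_map]; rfl
    have hIoi0 : ∑ l' ∈ Finset.Ioi (0 : Fin (M + 1)), q l' = ∑ l : Fin M, q l.succ := by
      rw [Fin.Ioi_zero_eq_map, Finset.sum_map]; rfl
    have hA : 0 ≤ ∑ l, q (Fin.succ l) := Finset.sum_nonneg fun l _ => hq _
    rw [sum_eq_sum_glueZero]
    have key : ∀ T : Finset ι, ∑ y : {i // i ∉ T} → Fin M, (∏ i, q (glueZero T y i)) *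
        (if ∃ l, cr l (k + levelCount (glueZero T y) l) then 1 else 0) ≤
        q 0 ^ T.card * H (Fintype.card ι - T.card) (∑ l, q (Fin.succ l)) := by
      intro T
      have hcard : Fintype.card {i // i ∉ T} = Fintype.card ι - T.card := by
        rw [Fintype.card_subtype_compl, Fintype.card_coe]
      have hTc : T.card ≤ Fintype.card ι := T.card_le_univ
      simp only [prod_glueZero, mul_assoc]
      rw [← Finset.mul_sum]
      refine mul_le_mul_of_nonneg_left ?_ (pow_nonneg (hq 0) _)
      rw [← hcard]
      by_cases h0 : cr 0 (k + T.card)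
      · refine (Finset.sum_le_sum fun y _ => mul_le_of_le_one_right
          (Finset.prod_nonneg fun i _ => hq _) (by split_ifs <;> norm_num)).trans ?_
        have h1 := hcr 0 _ (Fintype.card {i // i ∉ T}) (by rw [hcard]; omega) h0
        rw [hIoi0] at h1
        refine le_trans (le_of_eq ?_) h1
        rw [← Finset.card_univ, ← Finset.prod_const, Finset.prod_univ_sum]
        simp
      · have := ih (fun l => q l.succ) (fun l => hq _) (fun l k' => cr l.succ k') (k + T.card)
          (ι := {i // i ∉ T}) (by rw [hcard]; omega) (fun l k' n' h1 h2 => by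
            have := hcr l.succ k' n' h1 h2
            rwa [hIoi] at this)
        refine le_trans (le_of_eq (Finset.sum_congr rfl fun y _ => ?_)) this
        congr 2
        rw [Fin.exists_fin_succ, levelCount_glueZero_zero]
        simp only [levelCount_glueZero_succ, h0, false_or, add_assoc]
    refine (Finset.sum_le_sum fun T _ => key T).trans ?_
    rw [← Finset.powerset_univ, Finset.sum_powerset_apply_card
      (fun j => q 0 ^ j * H (Fintype.card ι - j) (∑ l, q (Fin.succ l))), Fin.sum_univ_succ,
      Finset.card_univ]
    simp only [nsmul_eq_mul]
    exact hstep _ _ _ (hq 0) hA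

/-! ### The exponential bound for identical cell probabilities -/

/-- The product of `A ^ n` and `n! / (n + m)! * A ^ m`. When `n` points lie in the remaining cells,
of total weight `A`, the second factor is, up to normalisation, the likelihood ratio of the counts
found so far for a sample with `m` additional points against the original one. -/
noncomputable def tiltKernel (m n : ℕ) (A : ℝ) : ℝ :=
  (n.factorial : ℝ) / ((n + m).factorial : ℝ) * A ^ (n + m)

theorem tiltKernel_nonneg (m n : ℕ) {A : ℝ} (hA : 0 ≤ A) : 0 ≤ tiltKernel m n A := by
  unfold tiltKernel; positivity

theorem sum_choose_mul_tiltKernel_le (m n : ℕ) {a A : ℝ} (ha : 0 ≤ a) (hA : 0 ≤ A) :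
    ∑ j ∈ Finset.range (n + 1), (n.choose j : ℝ) * (a ^ j * tiltKernel m (n - j) A) ≤
      tiltKernel m n (a + A) := by
  unfold tiltKernel
  rw [add_pow, Finset.mul_sum]
  have hsub : Finset.range (n + 1) ⊆ Finset.range (n + m + 1) :=
    Finset.range_subset_range.2 (by omega)
  refine le_trans (le_of_eq (Finset.sum_congr rfl fun j hj => ?_))
    (Finset.sum_le_sum_of_subset_of_nonneg hsub fun _ _ _ => by positivity)
  have hj : j ≤ n := by simpa [Nat.lt_succ_iff] using hj
  have e : n - j + m = n + m - j := by omega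
  rw [Nat.cast_choose ℝ hj, Nat.cast_choose ℝ (show j ≤ n + m by omega), e]
  have h1 : ((n - j).factorial : ℝ) ≠ 0 := by positivity
  have h2 : (j.factorial : ℝ) ≠ 0 := by positivity
  have h3 : ((n + m).factorial : ℝ) ≠ 0 := by positivity
  have h4 : ((n + m - j).factorial : ℝ) ≠ 0 := by positivity
  field_simp

/-- The exponential of `logGain` is the normalised likelihood ratio. -/
theorem pow_mul_exp_logGain {N : ℕ} (hN : 0 < N) (n m : ℕ) {A : ℝ} (hA : 0 < A) :
    A ^ n * Real.exp (logGain N n (N * A) m) =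
      ((N + m).factorial : ℝ) / (N.factorial : ℝ) * tiltKernel m n A := by
  have hN' : (0 : ℝ) < N := by exact_mod_cast hN
  have key : Real.exp (logGain N n (N * A) m) = ((N + m).factorial : ℝ) / (N.factorial : ℝ) *
      ((n.factorial : ℝ) / ((n + m).factorial : ℝ) * A ^ m) := by
    induction m with
    | zero =>
      have h1 : (N.factorial : ℝ) ≠ 0 := by positivity
      have h2 : (n.factorial : ℝ) ≠ 0 := by positivity
      simp [logGain, h1, h2]
    | succ m ih =>
      unfold logGain at ih ⊢
      rw [Finset.sum_range_succ, Real.exp_add, ih, Real.exp_sub, Real.exp_sub, Real.exp_add,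
        Real.exp_log (by positivity), Real.exp_log (by positivity), Real.exp_log hN',
        Real.exp_log (by positivity), ← add_assoc, ← add_assoc,
        show N + (m + 1) = N + m + 1 from rfl, show n + (m + 1) = n + m + 1 from rfl,
        Nat.factorial_succ,
        Nat.factorial_succ]
      push_cast
      have h1 : (N.factorial : ℝ) ≠ 0 := by positivity
      have h2 : ((n + m).factorial : ℝ) ≠ 0 := by positivity
      have h3 : (n : ℝ) + m + 1 ≠ 0 := by positivity
      have h4 : (n : ℝ) + (m + 1) ≠ 0 := by positivity
      field_simp
      ring
  rw [key, tiltKernel, pow_add]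
  ring

/-- The mass of the cells up to `l`. -/
def cumWeight {M : ℕ} (q : Fin M → ℝ) (l : Fin M) : ℝ := ∑ l' ∈ Finset.Iic l, q l'

theorem sum_Ioi_eq_one_sub_cumWeight {M : ℕ} {q : Fin M → ℝ} (hq1 : ∑ l, q l = 1) (l : Fin M) :
    ∑ l' ∈ Finset.Ioi l, q l' = 1 - cumWeight q l := by
  rw [cumWeight, ← hq1, ← Finset.sum_add_sum_compl (Finset.Iic l), add_sub_cancel_left]
  congr 1
  ext; simp

/-- Cells of weight zero contain no points, so that the count below a level of weight zero
vanishes on the support. -/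
theorem prod_eq_zero_of_cumWeight_eq_zero {M N : ℕ} {q : Fin M → ℝ} (hq : ∀ l, 0 ≤ q l)
    {l : Fin M} (hl : cumWeight q l = 0) {x : Fin N → Fin M} (hx : 0 < levelCount x l) :
    ∏ i, q (x i) = 0 := by
  obtain ⟨i, hi⟩ := Finset.card_pos.1 hx
  refine Finset.prod_eq_zero (Finset.mem_univ i) ?_
  exact (Finset.sum_eq_zero_iff_of_nonneg fun l _ => hq l).1 hl _
    (Finset.mem_Iic.2 (Finset.mem_filter.1 hi).2)

open Classical in
/-- The probability that the count at some level exceeds its mean by `c`, for `N` points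
distributed independently over the cells according to `q`. -/
noncomputable def crossingWeight {M : ℕ} (N : ℕ) (q : Fin M → ℝ) (c : ℝ) : ℝ :=
  ∑ x : Fin N → Fin M, (∏ i, q (x i)) *
    (if ∃ l, N * cumWeight q l + c ≤ levelCount x l then 1 else 0)

open Classical in
/-- A mixture of likelihood ratios that is at least `1 / C` at every crossing bounds the crossing
probability by `C`. -/
theorem crossingWeight_le_of_weights {M N : ℕ} (hN : 0 < N) {q : Fin M → ℝ} (hq : ∀ l, 0 ≤ q l)
    (hq1 : ∑ l, q l = 1) {c : ℝ} (hc : 0 < c) (s : Finset ℕ) (w : ℕ → ℝ)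
    (hw : ∀ m ∈ s, 0 ≤ w m) (hw1 : ∑ m ∈ s, w m = 1) {C : ℝ} (hC : 0 ≤ C)
    (hb : ∀ (n : ℕ) (A : ℝ), 0 < A → A < 1 → n + c ≤ N * A →
      1 ≤ C * ∑ m ∈ s, w m * Real.exp (logGain N n (N * A) m)) :
    crossingWeight N q c ≤ C := by
  have hN' : (0 : ℝ) < N := by exact_mod_cast hN
  set H : ℕ → ℝ → ℝ := fun n A => C * ∑ m ∈ s, w m *
    (((N + m).factorial : ℝ) / (N.factorial : ℝ) * tiltKernel m n A) with hH
  have hHN : H N 1 = C := by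
    rw [hH]
    have : ∀ m ∈ s, w m * (((N + m).factorial : ℝ) / (N.factorial : ℝ) * tiltKernel m N 1) =
        w m := by
      intro m _
      unfold tiltKernel
      have h1 : (N.factorial : ℝ) ≠ 0 := by positivity
      have h2 : ((N + m).factorial : ℝ) ≠ 0 := by positivity
      field_simp
      simp
    simp only [Finset.sum_congr rfl this, hw1, mul_one]
  have main := crossing_sum_le_of_supermartingale N H
    (fun n A hA => mul_nonneg hC (Finset.sum_nonneg fun m hm => mul_nonneg (hw m hm)
      (mul_nonneg (by positivity) (tiltKernel_nonneg _ _ hA))))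
    (fun n a A ha hA => by
      simp only [hH]
      calc ∑ j ∈ Finset.range (n + 1), (n.choose j : ℝ) * (a ^ j * (C * ∑ m ∈ s, w m *
            (((N + m).factorial : ℝ) / (N.factorial : ℝ) * tiltKernel m (n - j) A)))
          = C * ∑ m ∈ s, w m * (((N + m).factorial : ℝ) / (N.factorial : ℝ) *
            ∑ j ∈ Finset.range (n + 1), (n.choose j : ℝ) * (a ^ j * tiltKernel m (n - j) A)) := by
            simp only [Finset.mul_sum]
            rw [Finset.sum_comm]
            refine Finset.sum_congr rfl fun m _ => Finset.sum_congr rfl fun j _ => ?_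
            ring
        _ ≤ _ := by
            refine mul_le_mul_of_nonneg_left (Finset.sum_le_sum fun m hm => ?_) hC
            exact mul_le_mul_of_nonneg_left (mul_le_mul_of_nonneg_left
              (sum_choose_mul_tiltKernel_le m n ha hA) (by positivity)) (hw m hm))
    M q hq (fun l k => 0 < cumWeight q l ∧ N * cumWeight q l + c ≤ k) 0 (ι := Fin N) (by simp)
    (fun l k n hkn ⟨hv, hcr⟩ => by
      rw [sum_Ioi_eq_one_sub_cumWeight hq1]
      have hkn' : (k : ℝ) + n = N := by exact_mod_cast hkn
      have hnA : n + c ≤ N * (1 - cumWeight q l) := by linarith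
      have hA : 0 < 1 - cumWeight q l := by
        by_contra h
        push Not at h
        have : (N : ℝ) * (1 - cumWeight q l) ≤ 0 := mul_nonpos_of_nonneg_of_nonpos hN'.le h
        have : (0 : ℝ) ≤ n := n.cast_nonneg
        linarith
      have h := mul_le_mul_of_nonneg_left (hb n _ hA (by linarith) hnA) (pow_nonneg hA.le n)
      rw [mul_one] at h
      refine h.trans (le_of_eq ?_)
      simp only [hH, ← pow_mul_exp_logGain hN n _ hA]
      rw [mul_left_comm, Finset.mul_sum]
      congr 1
      exact Finset.sum_congr rfl fun m _ => by ring)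
  rw [Fintype.card_fin, hq1, hHN] at main
  refine le_trans (le_of_eq (Finset.sum_congr rfl fun x _ => ?_)) main
  by_cases hx : ∏ i, q (x i) = 0
  · simp [hx]
  congr 1
  simp only [zero_add]
  refine if_congr (exists_congr fun l => ⟨fun h => ⟨?_, h⟩, fun h => h.2⟩) rfl rfl
  have hv0 : 0 ≤ cumWeight q l := Finset.sum_nonneg fun l _ => hq l
  refine hv0.lt_of_ne fun h0 => hx (prod_eq_zero_of_cumWeight_eq_zero hq h0.symm ?_)
  rw [← h0] at h
  have : (0 : ℝ) < levelCount x l := by linarith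
  exact_mod_cast this

/-- No count exceeds its mean by the number of points. -/
theorem crossingWeight_eq_zero {M N : ℕ} (hN : 0 < N) {q : Fin M → ℝ} (hq : ∀ l, 0 ≤ q l)
    {c : ℝ} (hc : (N : ℝ) ≤ c) : crossingWeight N q c = 0 := by
  classical
  have hN' : (0 : ℝ) < N := by exact_mod_cast hN
  refine Finset.sum_eq_zero fun x _ => ?_
  split_ifs with h
  · obtain ⟨l, hl⟩ := h
    have hv0 : 0 ≤ cumWeight q l := Finset.sum_nonneg fun l _ => hq l
    have h1 : (levelCount x l : ℝ) ≤ N := by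
      have := levelCount_le x l
      rw [Fintype.card_fin] at this
      exact_mod_cast this
    have h2 : (N : ℝ) * cumWeight q l ≤ 0 := by linarith
    have h3 : cumWeight q l = 0 := by nlinarith
    rw [prod_eq_zero_of_cumWeight_eq_zero hq h3, zero_mul]
    have : (0 : ℝ) < levelCount x l := by
      rw [h3] at hl; linarith
    exact_mod_cast this
  · simp

theorem logGain_mono {N a y y' : ℝ} (hy : 0 < y) (h : y ≤ y') (m : ℕ) :
    logGain N a y m ≤ logGain N a y' m :=
  Finset.sum_le_sum fun l _ => by linarith [Real.log_le_log hy h]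

/-- With `s = 1 / y`, this is the convexity of `logGain N (y - c) y m`; see `logGain_eq_inv`. -/
theorem convexOn_logGain_inv {N c : ℝ} (hc : 0 < c) (m : ℕ) :
    ConvexOn ℝ (Set.Ioc 0 (1 / c)) (fun s => ∑ l ∈ Finset.range m,
      (Real.log (N + (l + 1)) - Real.log N - Real.log (1 + ((l + 1) - c) * s))) := by
  have hterm : ∀ l : ℕ, ConvexOn ℝ (Set.Ioc 0 (1 / c))
      (fun s => Real.log (N + (l + 1)) - Real.log N - Real.log (1 + ((l + 1) - c) * s)) := by
    intro l
    have h := strictConcaveOn_log_Ioi.concaveOn.comp_affineMap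
      (AffineMap.const ℝ ℝ (1 : ℝ) + (((l : ℝ) + 1) - c) • AffineMap.id ℝ ℝ)
    have h' : ConcaveOn ℝ (Set.Ioc 0 (1 / c)) (fun s => Real.log (1 + ((l + 1) - c) * s)) := by
      refine h.subset (fun s hs => ?_) (convex_Ioc 0 (1 / c))
      have h1 : s * c ≤ 1 := by
        have := hs.2
        rwa [le_div_iff₀ hc] at this
      have h2 : 0 < ((l : ℝ) + 1) * s := mul_pos (by positivity) hs.1
      simp only [Set.mem_preimage, Set.mem_Ioi]
      simp
      nlinarith
    have := (convexOn_const (Real.log (N + (l + 1)) - Real.log N)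
      (convex_Ioc (0 : ℝ) (1 / c))).sub h'
    exact this
  induction m with
  | zero => simpa using convexOn_const (0 : ℝ) (convex_Ioc (0 : ℝ) (1 / c))
  | succ m ih =>
    simp only [Finset.sum_range_succ]
    exact ih.add (hterm m)

theorem logGain_eq_inv {N c y : ℝ} (hc : 0 < c) (hy : c ≤ y) (m : ℕ) :
    logGain N (y - c) y m = ∑ l ∈ Finset.range m,
      (Real.log (N + (l + 1)) - Real.log N - Real.log (1 + ((l + 1) - c) * y⁻¹)) := by
  refine Finset.sum_congr rfl fun l _ => ?_
  have hy0 : 0 < y := by linarith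
  have hl : (0 : ℝ) ≤ l := l.cast_nonneg
  rw [show 1 + ((l : ℝ) + 1 - c) * y⁻¹ = (y - c + (l + 1)) / y by field_simp; ring,
    Real.log_div (by linarith) hy0.ne']
  ring

/-- Since `logGain` is convex in `1/y`, the minimax principle provides one mixture over the number
of additional points that serves all crossing positions simultaneously. -/
theorem crossingWeight_le {M N : ℕ} {q : Fin M → ℝ} (hq : ∀ l, 0 ≤ q l)
    (hq1 : ∑ l, q l = 1) {c : ℝ} (hc : 1 ≤ c) (hcN : c < N) :
    crossingWeight N q c ≤
      Real.exp (-(2 * c * (c - 1) / N - 1 / 2 * Real.log (1 - c / N))) := by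
  have hc0 : 0 < c := by linarith
  have hN' : (0 : ℝ) < N := by linarith
  have hN : 0 < N := by exact_mod_cast hN'
  set F := 2 * c * (c - 1) / N - 1 / 2 * Real.log (1 - c / N) with hF
  -- the largest number of remaining points compatible with a crossing
  obtain ⟨n₀, hn₀⟩ : ∃ n₀, ⌈(N : ℝ) - c⌉₊ = n₀ + 1 :=
    Nat.exists_eq_succ_of_ne_zero (Nat.ceil_pos.2 (by linarith)).ne'
  have hn₀N : (n₀ : ℝ) < N - c := Nat.lt_ceil.1 (by omega)
  have hn₀max : ∀ n : ℕ, (n : ℝ) < N - c → n ≤ n₀ := fun n hn => by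
    have := Nat.lt_ceil.2 hn
    omega
  have hn₀0 : (0 : ℝ) ≤ n₀ := n₀.cast_nonneg
  set Y := n₀ + c with hY
  have hYN : Y < N := by linarith
  set L := ⌊N * c / (N - Y)⌋₊ with hL
  obtain ⟨w, hw0, hw1, hw⟩ := exists_weights_le_sum_of_convexOn (ι := Fin (L + 1))
    (S := Set.Icc (1 / Y) (1 / c)) (F := F)
    (f := fun m s => ∑ l ∈ Finset.range m,
      (Real.log (N + (l + 1)) - Real.log N - Real.log (1 + ((l + 1) - c) * s)))
    ⟨1 / c, Set.right_mem_Icc.2 (one_div_le_one_div_of_le hc0 (by linarith))⟩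
    (fun m => (convexOn_logGain_inv hc0 m).subset
      (fun s hs => ⟨lt_of_lt_of_le (by positivity) hs.1, hs.2⟩) (convex_Icc _ _))
    (fun s hs => by
      have hs0 : 0 < s := lt_of_lt_of_le (by positivity) hs.1
      have hy1 : c ≤ s⁻¹ := by
        rw [le_inv_comm₀ hc0 hs0, ← one_div]; exact hs.2
      have hy2 : s⁻¹ ≤ Y := by
        rw [inv_le_comm₀ hs0 (by linarith), ← one_div]; exact hs.1
      have h := (exists_le_logGain (a := s⁻¹ - c) (c := c) (N := N) (by linarith) hc
        (by linarith))
      rw [sub_add_cancel, logGain_eq_inv hc0 hy1, inv_inv] at h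
      refine ⟨⟨⌊N * c / (N - s⁻¹)⌋₊, Nat.lt_succ_of_le (Nat.floor_le_floor ?_)⟩, h⟩
      exact div_le_div_of_nonneg_left (by positivity) (by linarith) (by linarith))
  refine crossingWeight_le_of_weights hN hq hq1 hc0 (Finset.range (L + 1))
    (fun m => if h : m < L + 1 then w ⟨m, h⟩ else 0) (fun m hm => ?_) ?_ (Real.exp_pos _).le ?_
  · split_ifs
    · exact hw0 _
    · exact le_rfl
  · rw [Finset.sum_range]
    simp only [Fin.is_lt, dite_true, Fin.eta]
    exact hw1
  · intro n A hA hA1 hnA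
    have hn : (n : ℝ) < N - c := by nlinarith
    have hnn₀ : (n : ℝ) ≤ n₀ := by exact_mod_cast hn₀max n hn
    have hn0 : (0 : ℝ) ≤ n := n.cast_nonneg
    have hnc : 0 < n + c := by linarith
    have h1 := hw (n + c)⁻¹ ⟨by rw [one_div]; exact inv_anti₀ hnc (by linarith),
      by rw [one_div]; exact inv_anti₀ hc0 (by linarith)⟩
    have h2 : ∀ m : Fin (L + 1), ∑ l ∈ Finset.range m, (Real.log (N + (l + 1)) - Real.log N -
        Real.log (1 + ((l + 1) - c) * (n + c)⁻¹)) ≤ logGain N n (N * A) m := by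
      intro m
      rw [← logGain_eq_inv hc0 (by linarith), add_sub_cancel_right]
      exact logGain_mono hnc hnA m
    have h3 : Real.exp F ≤ ∑ m : Fin (L + 1), w m * Real.exp (logGain N n (N * A) m) := by
      refine (Real.exp_le_exp.2 (h1.trans (Finset.sum_le_sum fun m _ =>
        mul_le_mul_of_nonneg_left (h2 m) (hw0 m)))).trans ?_
      have := convexOn_exp.map_sum_le (t := Finset.univ) (w := w)
        (p := fun m : Fin (L + 1) => logGain N n (N * A) m) (fun m _ => hw0 m) hw1
        (fun _ _ => Set.mem_univ _)
      simpa [smul_eq_mul] using this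
    rw [Finset.sum_range]
    simp only [Fin.is_lt, dite_true, Fin.eta]
    have h4 := mul_le_mul_of_nonneg_left h3 (Real.exp_pos (-F)).le
    rwa [← Real.exp_add, neg_add_cancel, Real.exp_zero] at h4

/-! ### Comparison with identically distributed variables -/

/-- The positive part of the largest excess of the counts of `x` over the integer levels `β`. -/
def excess {ι K : Type*} [Fintype ι] [Fintype K] [LinearOrder K] (β : K → ℤ) (x : ι → K) : ℕ :=
  Finset.univ.sup fun l => ((levelCount x l : ℤ) - β l).toNat

/-- The expectation of `T` under the product of the weights `p i`. -/
def productMean {ι K : Type*} [Fintype ι] [DecidableEq ι] [Fintype K] (p : ι → K → ℝ)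
    (T : (ι → K) → ℝ) : ℝ :=
  ∑ x : ι → K, (∏ i, p i (x i)) * T x

/-- As a function of the positions of two of the points, the maximal excess is the sum of an
additive part and a product `g a * g b`. -/
theorem exists_sup_two_points_eq {K : Type*} [Fintype K] [LinearOrder K] (r : K → ℤ) :
    ∃ (ρ : ℝ) (u g : K → ℝ), ∀ a b, (((Finset.univ.sup fun l =>
      (r l + (if a ≤ l then 1 else 0) + (if b ≤ l then 1 else 0)).toNat : ℕ)) : ℝ) =
        ρ + u a + u b + g a * g b := by
  classical
  set ρ : ℕ := Finset.univ.sup fun l => (r l).toNat with hρ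
  have hr : ∀ l, r l ≤ ρ := fun l => by
    have : (r l).toNat ≤ ρ := Finset.le_sup (f := fun l => (r l).toNat) (Finset.mem_univ l)
    omega
  -- `U a`: a point at `a` contributes to a maximal level; `W a`: to an almost maximal one
  set U : K → Prop := fun a => ∃ l, a ≤ l ∧ (ρ : ℤ) ≤ r l with hU
  set W : K → Prop := fun a => ∃ l, a ≤ l ∧ (ρ : ℤ) - 1 ≤ r l with hW
  have hUW : ∀ a, U a → W a := fun a ⟨l, h1, h2⟩ => ⟨l, h1, by omega⟩
  refine ⟨ρ, fun a => if U a then 1 else 0, fun a => if W a ∧ ¬ U a then 1 else 0, fun a b => ?_⟩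
  set f : K → ℕ := fun l =>
    (r l + (if a ≤ l then 1 else 0) + (if b ≤ l then 1 else 0)).toNat with hf
  set t : ℕ := Finset.univ.sup f with ht
  have hft : ∀ l, f l ≤ t := fun l => Finset.le_sup (Finset.mem_univ l)
  have lo0 : ρ ≤ t := Finset.sup_mono_fun fun l _ => by
    simp only [hf]; split_ifs <;> omega
  have lo1 : U a ∨ U b → ρ + 1 ≤ t := by
    rintro (⟨l, h1, h2⟩ | ⟨l, h1, h2⟩) <;>
    · refine le_trans ?_ (hft l)
      simp only [hf, h1, if_true]
      split_ifs <;> omega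
  have lo1' : W a ∧ W b → ρ + 1 ≤ t := by
    rintro ⟨⟨l, h1, h2⟩, ⟨l', h1', h2'⟩⟩
    refine le_trans ?_ (hft (max l l'))
    simp only [hf, h1.trans (le_max_left l l'), h1'.trans (le_max_right l l'), if_true]
    rcases max_choice l l' with h | h <;> rw [h] <;> omega
  have lo2 : U a ∧ U b → ρ + 2 ≤ t := by
    rintro ⟨⟨l, h1, h2⟩, ⟨l', h1', h2'⟩⟩
    refine le_trans ?_ (hft (max l l'))
    simp only [hf, h1.trans (le_max_left l l'), h1'.trans (le_max_right l l'), if_true]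
    rcases max_choice l l' with h | h <;> rw [h] <;> omega
  have up2 : t ≤ ρ + 2 := Finset.sup_le fun l _ => by
    have := hr l
    simp only [hf]; split_ifs <;> omega
  have up1 : ¬ (U a ∧ U b) → t ≤ ρ + 1 := fun h => Finset.sup_le fun l _ => by
    have := hr l
    simp only [hf]
    by_contra hc
    apply h
    constructor <;> refine ⟨l, ?_, ?_⟩ <;> (split_ifs at hc <;> first | assumption | omega)
  have up0 : ¬ U a → ¬ U b → ¬ (W a ∧ W b) → t ≤ ρ := fun h1 h2 h3 => Finset.sup_le fun l _ => by
    have := hr l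
    simp only [hf]
    by_contra hc
    by_cases ha : a ≤ l <;> by_cases hb : b ≤ l <;> simp only [ha, hb, if_true, if_false] at hc
    · exact h3 ⟨⟨l, ha, by omega⟩, ⟨l, hb, by omega⟩⟩
    · exact h1 ⟨l, ha, by omega⟩
    · exact h2 ⟨l, hb, by omega⟩
    · omega
  by_cases ha : U a <;> by_cases hb : U b
  · have : t = ρ + 2 := le_antisymm up2 (lo2 ⟨ha, hb⟩)
    rw [this]; simp [ha, hb]; ring
  · have : t = ρ + 1 := le_antisymm (up1 fun h => hb h.2) (lo1 (Or.inl ha))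
    rw [this]; simp [ha, hb]
  · have : t = ρ + 1 := le_antisymm (up1 fun h => ha h.1) (lo1 (Or.inr hb))
    rw [this]; simp [ha, hb]
  · by_cases h : W a ∧ W b
    · have : t = ρ + 1 := le_antisymm (up1 fun h => ha h.1) (lo1' h)
      rw [this]; simp [ha, hb, h.1, h.2]
    · have : t = ρ := le_antisymm (up0 ha hb h) lo0
      rw [this]
      simp only [ha, hb, not_false_eq_true, and_true, if_false, add_zero]
      rcases not_and_or.1 h with h | h <;> simp [h]

theorem sum_sum_update {ι K : Type*} [Fintype ι] [DecidableEq ι] [Fintype K] (i : ι)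
    (G : (ι → K) → ℝ) :
    ∑ x, ∑ a, G (Function.update x i a) = Fintype.card K * ∑ x, G x := by
  -- exchanging `a` with the `i`-th coordinate is an involution
  have h : ∑ z : (ι → K) × K, G (Function.update z.1 i z.2) = ∑ z : (ι → K) × K, G z.1 := by
    refine Fintype.sum_equiv (Function.Involutive.toPerm
      (fun z : (ι → K) × K => (Function.update z.1 i z.2, z.1 i)) fun z => ?_) _ _ fun z => rfl
    simp
  rw [Fintype.sum_prod_type, Fintype.sum_prod_type] at h
  rw [h]
  simp [Finset.mul_sum]

theorem sum_sum_sum_update {ι K : Type*} [Fintype ι] [DecidableEq ι] [Fintype K] (i j : ι)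
    (G : (ι → K) → ℝ) :
    ∑ x, ∑ a, ∑ b, G (Function.update (Function.update x i a) j b) =
      (Fintype.card K : ℝ) ^ 2 * ∑ x, G x := by
  rw [sum_sum_update i (fun x => ∑ b, G (Function.update x j b)), sum_sum_update]
  ring

theorem prod_update_update {ι K : Type*} [Fintype ι] [DecidableEq ι] {i j : ι} (hij : i ≠ j)
    (p : ι → K → ℝ) (x : ι → K) (a b : K) :
    ∏ r, p r (Function.update (Function.update x i a) j b r) =
      p i a * p j b * ∏ r ∈ (Finset.univ.erase i).erase j, p r (x r) := by
  have hj : j ∈ Finset.univ.erase i := Finset.mem_erase.2 ⟨hij.symm, Finset.mem_univ j⟩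
  rw [← Finset.mul_prod_erase _ _ (Finset.mem_univ i), ← Finset.mul_prod_erase _ _ hj, ← mul_assoc]
  congr 1
  · simp [hij]
  · refine Finset.prod_congr rfl fun r hr => ?_
    simp only [Finset.mem_erase, Finset.mem_univ, and_true] at hr
    rw [Function.update_of_ne hr.1, Function.update_of_ne hr.2]

theorem levelCount_update_update {ι K : Type*} [Fintype ι] [DecidableEq ι] [LinearOrder K]
    {i j : ι} (hij : i ≠ j) (x : ι → K) (a b l : K) :
    (levelCount (Function.update (Function.update x i a) j b) l : ℤ) =
      ∑ r ∈ (Finset.univ.erase i).erase j, (if x r ≤ l then 1 else 0) +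
        (if a ≤ l then 1 else 0) + (if b ≤ l then 1 else 0) := by
  have hj : j ∈ Finset.univ.erase i := Finset.mem_erase.2 ⟨hij.symm, Finset.mem_univ j⟩
  rw [levelCount, Finset.card_filter]
  push_cast
  rw [← Finset.add_sum_erase _ _ (Finset.mem_univ i), ← Finset.add_sum_erase _ _ hj]
  have : ∑ r ∈ (Finset.univ.erase i).erase j,
      (if Function.update (Function.update x i a) j b r ≤ l then (1 : ℤ) else 0) =
      ∑ r ∈ (Finset.univ.erase i).erase j, (if x r ≤ l then 1 else 0) := by
    refine Finset.sum_congr rfl fun r hr => ?_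
    simp only [Finset.mem_erase, Finset.mem_univ, and_true] at hr
    rw [Function.update_of_ne hr.1, Function.update_of_ne hr.2]
  rw [this]
  simp [hij]
  ring

/-- The family `p` in which both `p i` and `p j` are replaced by their average. -/
noncomputable def averagePair {ι K : Type*} [DecidableEq ι] (p : ι → K → ℝ) (i j : ι) :
    ι → K → ℝ :=
  Function.update (Function.update p i fun a => (p i a + p j a) / 2) j
    fun a => (p i a + p j a) / 2

/-- Averaging two of the distributions increases the mean maximal excess: by the decomposition of
`exists_sup_two_points_eq` this is the inequality between arithmetic and geometric mean. -/
theorem productMean_excess_le_averagePair {ι K : Type*} [Fintype ι] [DecidableEq ι] [Fintype K]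
    [Nonempty K] [LinearOrder K] (β : K → ℤ) {p : ι → K → ℝ} (hp : ∀ i l, 0 ≤ p i l)
    (hp1 : ∀ i, ∑ l, p i l = 1) {i j : ι} (hij : i ≠ j) :
    productMean p (fun x => excess β x) ≤ productMean (averagePair p i j) fun x => excess β x := by
  have hcard : (0 : ℝ) < (Fintype.card K : ℝ) ^ 2 := by positivity
  refine le_of_mul_le_mul_left ?_ hcard
  unfold productMean
  rw [← sum_sum_sum_update i j, ← sum_sum_sum_update i j]
  refine Finset.sum_le_sum fun x _ => ?_
  obtain ⟨ρ, u, g, h⟩ := exists_sup_two_points_eq fun l =>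
    ∑ r ∈ (Finset.univ.erase i).erase j, (if x r ≤ l then (1 : ℤ) else 0) - β l
  have hT : ∀ a b, (excess β (Function.update (Function.update x i a) j b) : ℝ) =
      ρ + u a + u b + g a * g b := by
    intro a b
    rw [← h a b, excess]
    congr 2
    funext l
    rw [levelCount_update_update hij]
    congr 1
    ring
  have expand : ∀ (c : ℝ) (P Q : K → ℝ), ∑ l, P l = 1 → ∑ l, Q l = 1 →
      ∑ a, ∑ b, P a * Q b * c * (ρ + u a + u b + g a * g b) =
        c * (ρ + ∑ a, P a * u a + ∑ a, Q a * u a + (∑ a, P a * g a) * ∑ a, Q a * g a) := by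
    intro c P Q hP hQ
    have h1 : ∀ a, ∑ b, P a * Q b * c * (ρ + u a + u b + g a * g b) =
        c * (P a * ρ + P a * u a + P a * (∑ b, Q b * u b) + P a * g a * ∑ b, Q b * g b) := by
      intro a
      have : ∀ b, P a * Q b * c * (ρ + u a + u b + g a * g b) =
          c * (P a * (ρ + u a)) * Q b + c * P a * (Q b * u b) + c * (P a * g a) * (Q b * g b) :=
        fun b => by ring
      simp only [this, Finset.sum_add_distrib, ← Finset.mul_sum, hQ]
      ring
    simp only [h1, ← Finset.mul_sum, Finset.sum_add_distrib, ← Finset.sum_mul, hP, one_mul]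
  have hcj : averagePair p i j j = fun a => (p i a + p j a) / 2 := by simp [averagePair]
  have hci : averagePair p i j i = fun a => (p i a + p j a) / 2 := by simp [averagePair, hij]
  have hrest : ∏ r ∈ (Finset.univ.erase i).erase j, averagePair p i j r (x r) =
      ∏ r ∈ (Finset.univ.erase i).erase j, p r (x r) := by
    refine Finset.prod_congr rfl fun r hr => ?_
    simp only [Finset.mem_erase, Finset.mem_univ, and_true] at hr
    rw [averagePair, Function.update_of_ne hr.1, Function.update_of_ne hr.2]
  have hm : ∑ a, (p i a + p j a) / 2 = 1 := by
    rw [← Finset.sum_div, Finset.sum_add_distrib, hp1, hp1]; norm_num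
  simp only [prod_update_update hij, hT, hrest, hci, hcj]
  rw [expand _ _ _ (hp1 i) (hp1 j), expand _ _ _ hm hm]
  refine mul_le_mul_of_nonneg_left ?_ (Finset.prod_nonneg fun r _ => hp r _)
  have e : ∀ v : K → ℝ, ∑ a, (p i a + p j a) / 2 * v a =
      (∑ a, p i a * v a + ∑ a, p j a * v a) / 2 := by
    intro v
    rw [← Finset.sum_add_distrib, Finset.sum_div]
    exact Finset.sum_congr rfl fun a _ => by ring
  rw [e, e]
  nlinarith [sq_nonneg (∑ a, p i a * g a - ∑ a, p j a * g a)]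

theorem sum_averagePair {ι K : Type*} [Fintype ι] [DecidableEq ι] {i j : ι} (hij : i ≠ j)
    (p : ι → K → ℝ) (φ : ℝ → ℝ) (l : K) :
    ∑ r, φ (averagePair p i j r l) =
      ∑ r, φ (p r l) + (2 * φ ((p i l + p j l) / 2) - φ (p i l) - φ (p j l)) := by
  have hj : j ∈ Finset.univ.erase i := Finset.mem_erase.2 ⟨hij.symm, Finset.mem_univ j⟩
  rw [← Finset.add_sum_erase _ _ (Finset.mem_univ i), ← Finset.add_sum_erase _ _ hj,
    ← Finset.add_sum_erase _ (fun r => φ (p r l)) (Finset.mem_univ i),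
    ← Finset.add_sum_erase _ (fun r => φ (p r l)) hj]
  have : ∑ r ∈ (Finset.univ.erase i).erase j, φ (averagePair p i j r l) =
      ∑ r ∈ (Finset.univ.erase i).erase j, φ (p r l) := by
    refine Finset.sum_congr rfl fun r hr => ?_
    simp only [Finset.mem_erase, Finset.mem_univ, and_true] at hr
    rw [averagePair, Function.update_of_ne hr.1, Function.update_of_ne hr.2]
  rw [this]
  simp [averagePair, hij]
  ring

/-- A continuous function of a family of distributions that does not decrease under pairwise
averaging is largest when all of them equal their mean: among the maximisers with the given mean,
one of least square sum has equal members. -/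
theorem le_apply_mean_of_le_averagePair {ι K : Type*} [Fintype ι] [DecidableEq ι] [Nonempty ι]
    [Fintype K] {F : (ι → K → ℝ) → ℝ} (hF : Continuous F)
    (havg : ∀ p : ι → K → ℝ, (∀ i l, 0 ≤ p i l) → (∀ i, ∑ l, p i l = 1) →
      ∀ i j, i ≠ j → F p ≤ F (averagePair p i j))
    {p : ι → K → ℝ} (hp : ∀ i l, 0 ≤ p i l) (hp1 : ∀ i, ∑ l, p i l = 1) :
    F p ≤ F fun _ l => (∑ i, p i l) / Fintype.card ι := by
  set D : Set (ι → K → ℝ) := {r | (∀ i l, 0 ≤ r i l) ∧ (∀ i, ∑ l, r i l = 1) ∧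
    ∀ l, ∑ i, r i l = ∑ i, p i l} with hD
  have hDc : IsCompact D := by
    refine (isCompact_Icc (a := (0 : ι → K → ℝ)) (b := 1)).of_isClosed_subset ?_ ?_
    · have e : D = (⋂ i, ⋂ l, {r | 0 ≤ r i l}) ∩ ((⋂ i, {r | ∑ l, r i l = 1}) ∩
          ⋂ l, {r | ∑ i, r i l = ∑ i, p i l}) := by
        ext r; simp [hD]
      rw [e]
      refine IsClosed.inter ?_ (IsClosed.inter ?_ ?_)
      · exact isClosed_iInter fun i => isClosed_iInter fun l =>
          isClosed_le continuous_const (by fun_prop)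
      · exact isClosed_iInter fun i => isClosed_eq (by fun_prop) continuous_const
      · exact isClosed_iInter fun l => isClosed_eq (by fun_prop) continuous_const
    · rintro r ⟨h0, h1, _⟩
      refine ⟨fun i l => h0 i l, fun i l => ?_⟩
      rw [Pi.one_apply, Pi.one_apply, ← h1 i]
      exact Finset.single_le_sum (fun l _ => h0 i l) (Finset.mem_univ l)
  have hpD : p ∈ D := ⟨hp, hp1, fun _ => rfl⟩
  obtain ⟨r, hr, hrmax⟩ := hDc.exists_isMaxOn ⟨p, hpD⟩ hF.continuousOn
  have hD'c : IsCompact (D ∩ {s | F r ≤ F s}) :=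
    hDc.inter_right (isClosed_le continuous_const hF)
  obtain ⟨s, ⟨hsD, hsF⟩, hsmin⟩ := hD'c.exists_isMinOn ⟨r, hr, le_refl (F r)⟩
    (f := fun s : ι → K → ℝ => ∑ l, ∑ i, s i l ^ 2) (by fun_prop)
  have heq : ∀ i j, s i = s j := by
    intro i j
    by_contra hne
    have hij : i ≠ j := fun h => hne (by rw [h])
    have hav : averagePair s i j ∈ D ∩ {s | F r ≤ F s} := by
      refine ⟨⟨fun k l => ?_, fun k => ?_, fun l => ?_⟩,
        le_trans hsF (havg s hsD.1 hsD.2.1 i j hij)⟩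
      · have h1 := hsD.1 i l
        have h2 := hsD.1 j l
        rcases eq_or_ne k j with rfl | hkj
        · simp [averagePair]; linarith
        · rcases eq_or_ne k i with rfl | hki
          · simp [averagePair, hkj]; linarith
          · simpa [averagePair, hkj, hki] using hsD.1 k l
      · have hm : ∑ a, (s i a + s j a) / 2 = 1 := by
          rw [← Finset.sum_div, Finset.sum_add_distrib, hsD.2.1, hsD.2.1]; norm_num
        rcases eq_or_ne k j with rfl | hkj
        · simpa [averagePair] using hm
        · rcases eq_or_ne k i with rfl | hki
          · simpa [averagePair, hkj] using hm
          · simpa [averagePair, hkj, hki] using hsD.2.1 k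
      · rw [← hsD.2.2 l]
        have := sum_averagePair hij s id l
        simp only [id] at this
        rw [this]; ring
    have hle := hsmin hav
    simp only [Set.mem_ofPred_eq, sum_averagePair hij s (fun t => t ^ 2)] at hle
    rw [Finset.sum_add_distrib] at hle
    have hsq : ∀ l, 2 * ((s i l + s j l) / 2) ^ 2 - s i l ^ 2 - s j l ^ 2 =
        -((s i l - s j l) ^ 2 / 2) := fun l => by ring
    simp only [hsq, Finset.sum_neg_distrib] at hle
    have h0 : ∑ l, (s i l - s j l) ^ 2 / 2 = 0 :=
      le_antisymm (by linarith) (Finset.sum_nonneg fun l _ => by positivity)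
    apply hne
    funext l
    have := (Finset.sum_eq_zero_iff_of_nonneg fun l _ => by positivity).1 h0 l (Finset.mem_univ l)
    nlinarith
  have hs : s = fun _ l => (∑ i, p i l) / Fintype.card ι := by
    funext i l
    rw [← hsD.2.2 l, Finset.sum_congr rfl fun k _ => by rw [heq k i]]
    simp
  rw [← hs]
  exact (hrmax hpD).trans hsF

theorem productMean_excess_le_mean {ι K : Type*} [Fintype ι] [DecidableEq ι] [Nonempty ι]
    [Fintype K] [Nonempty K] [LinearOrder K] (β : K → ℤ) {p : ι → K → ℝ}
    (hp : ∀ i l, 0 ≤ p i l) (hp1 : ∀ i, ∑ l, p i l = 1) :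
    productMean p (fun x => excess β x) ≤
      productMean (fun _ l => (∑ i, p i l) / Fintype.card ι) fun x : ι → K => (excess β x : ℝ) := by
  refine le_apply_mean_of_le_averagePair
    (F := fun p => productMean p fun x : ι → K => (excess β x : ℝ)) ?_
    (fun p hp hp1 i j hij => productMean_excess_le_averagePair β hp hp1 hij) hp hp1
  unfold productMean
  fun_prop

open Classical in
/-- The probability of exceeding the mean level by `c`, for independent points with different
distributions, is at most an average of such probabilities for identically distributed points,
over the `N` consecutive excesses starting at `c - z + 1`. -/
theorem sum_crossing_le_sum_crossingWeight {M N : ℕ} (hN : 0 < N) {p : Fin N → Fin M → ℝ}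
    (hp : ∀ i l, 0 ≤ p i l) (hp1 : ∀ i, ∑ l, p i l = 1) {c : ℝ} {z : ℕ} (hz : 0 < z)
    (hzc : (z : ℝ) ≤ c) :
    ∑ x : Fin N → Fin M, (∏ i, p i (x i)) *
      (if ∃ l, ∑ i, cumWeight (p i) l + c ≤ levelCount x l then 1 else 0) ≤
      1 / z * ∑ i ∈ Finset.range N,
        crossingWeight N (fun l => (∑ r, p r l) / N) (c - z + (i + 1)) := by
  have hN' : (0 : ℝ) < N := by exact_mod_cast hN
  have hz' : (0 : ℝ) < z := by exact_mod_cast hz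
  have : Nonempty (Fin N) := ⟨⟨0, hN⟩⟩
  have : Nonempty (Fin M) := by
    by_contra h
    rw [not_nonempty_iff] at h
    have := hp1 ⟨0, hN⟩
    simp at this
  set q : Fin M → ℝ := fun l => (∑ r, p r l) / N with hq
  have hb : ∀ l, ∑ i, cumWeight (p i) l = N * cumWeight q l := by
    intro l
    simp only [cumWeight, hq]
    rw [Finset.sum_comm, Finset.mul_sum]
    exact Finset.sum_congr rfl fun l' _ => by field_simp
  have hq0 : ∀ l, 0 ≤ q l := fun l => div_nonneg (Finset.sum_nonneg fun i _ => hp i l) hN'.le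
  have hv0 : ∀ l, 0 ≤ N * cumWeight q l := fun l =>
    mul_nonneg hN'.le (Finset.sum_nonneg fun l _ => hq0 l)
  set β : Fin M → ℤ := fun l => ⌈N * cumWeight q l + c⌉ - z with hβ
  have hβ0 : ∀ l, 0 ≤ β l := by
    intro l
    simp only [hβ, sub_nonneg]
    rw [Int.le_ceil_iff]
    push_cast
    linarith [hv0 l]
  have h1 : ∀ x : Fin N → Fin M,
      (if ∃ l, ∑ i, cumWeight (p i) l + c ≤ levelCount x l then (1 : ℝ) else 0) ≤
        1 / z * excess β x := by
    intro x
    split_ifs with h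
    · obtain ⟨l, hl⟩ := h
      rw [hb] at hl
      have hc : ⌈N * cumWeight q l + c⌉ ≤ (levelCount x l : ℤ) := Int.ceil_le.2 (by exact_mod_cast hl)
      have : z ≤ excess β x := by
        refine le_trans ?_ (Finset.le_sup (f := fun l => ((levelCount x l : ℤ) - β l).toNat)
          (Finset.mem_univ l))
        simp only [hβ]; omega
      rw [one_div, inv_mul_eq_div, le_div_iff₀ hz', one_mul]
      exact_mod_cast this
    · positivity
  have h2 : ∀ x : Fin N → Fin M, (excess β x : ℝ) ≤ ∑ i ∈ Finset.range N,
      (if ∃ l, N * cumWeight q l + (c - z + (i + 1)) ≤ levelCount x l then (1 : ℝ) else 0) := by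
    intro x
    have hexN : excess β x ≤ N := Finset.sup_le fun l _ => by
      have := levelCount_le x l
      rw [Fintype.card_fin] at this
      have := hβ0 l
      omega
    calc (excess β x : ℝ) = ∑ i ∈ Finset.range (excess β x), (1 : ℝ) := by simp
      _ = ∑ i ∈ Finset.range (excess β x),
          (if ∃ l, N * cumWeight q l + (c - z + (i + 1)) ≤ levelCount x l then (1 : ℝ) else 0) := by
          refine Finset.sum_congr rfl fun i hi => ?_
          rw [if_pos]
          have hi : i < excess β x := Finset.mem_range.1 hi
          obtain ⟨l, _, hl⟩ := Finset.lt_sup_iff.1 hi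
          refine ⟨l, ?_⟩
          have h3 : ⌈N * cumWeight q l + c⌉ ≤ (levelCount x l : ℤ) + z - (i + 1) := by
            simp only [hβ] at hl; omega
          have := Int.ceil_le.1 h3
          push_cast at this
          linarith
      _ ≤ _ := Finset.sum_le_sum_of_subset_of_nonneg (Finset.range_subset_range.2 hexN)
          fun _ _ _ => by split_ifs <;> norm_num
  have hprod : ∀ x : Fin N → Fin M, 0 ≤ ∏ i, p i (x i) := fun x =>
    Finset.prod_nonneg fun i _ => hp i _
  calc _ ≤ ∑ x : Fin N → Fin M, (∏ i, p i (x i)) * (1 / z * excess β x) :=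
        Finset.sum_le_sum fun x _ => mul_le_mul_of_nonneg_left (h1 x) (hprod x)
    _ = 1 / z * productMean p fun x => (excess β x : ℝ) := by
        rw [productMean, Finset.mul_sum]
        exact Finset.sum_congr rfl fun x _ => by ring
    _ ≤ 1 / z * productMean (fun _ => q) fun x : Fin N → Fin M => (excess β x : ℝ) := by
        refine mul_le_mul_of_nonneg_left ?_ (by positivity)
        have := productMean_excess_le_mean β hp hp1
        rwa [Fintype.card_fin] at this
    _ ≤ _ := by
        refine mul_le_mul_of_nonneg_left ?_ (by positivity)
        unfold productMean crossingWeight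
        rw [Finset.sum_comm]
        refine Finset.sum_le_sum fun x _ => ?_
        rw [← Finset.mul_sum]
        exact mul_le_mul_of_nonneg_left (h2 x) (Finset.prod_nonneg fun i _ => hq0 _)

/-! ### Summation of the exponential bounds -/

theorem sum_exp_neg_le {θ : ℝ} (hθ : 0 < θ) (n : ℕ) :
    ∑ i ∈ Finset.range n, Real.exp (-θ * i) ≤ (1 - Real.exp (-θ))⁻¹ := by
  have h1 : Real.exp (-θ) < 1 := Real.exp_lt_one_iff.2 (by linarith)
  have : ∀ i : ℕ, Real.exp (-θ * i) = Real.exp (-θ) ^ i := fun i => by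
    rw [← Real.exp_nat_mul, mul_comm]
  simp only [this]
  rw [← tsum_geometric_of_lt_one (Real.exp_pos _).le h1]
  exact (summable_geometric_of_lt_one (Real.exp_pos _).le h1).sum_le_tsum _
    fun i _ => by positivity

/-- A geometric sum starting `z - 1` steps before the index `0`. -/
theorem sum_exp_shift_le {θ : ℝ} (hθ : 0 < θ) (n z : ℕ) :
    ∑ i ∈ Finset.range n, Real.exp (-θ * ((i : ℝ) + 1 - z)) ≤
      Real.exp (θ * z) / (Real.exp θ - 1) := by
  have h1 : 1 < Real.exp θ := Real.one_lt_exp_iff.2 hθ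
  have e : ∀ i : ℕ, Real.exp (-θ * ((i : ℝ) + 1 - z)) =
      Real.exp (θ * z) * Real.exp (-θ) * Real.exp (-θ * i) := fun i => by
    rw [← Real.exp_add, ← Real.exp_add]; congr 1; ring
  simp only [e, ← Finset.mul_sum]
  refine (mul_le_mul_of_nonneg_left (sum_exp_neg_le hθ n) (by positivity)).trans (le_of_eq ?_)
  rw [Real.exp_neg]
  have : Real.exp θ - 1 ≠ 0 := by linarith
  have h0 : Real.exp θ ≠ 0 := (Real.exp_pos θ).ne'
  have h2 : 1 - (Real.exp θ)⁻¹ ≠ 0 := by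
    rw [sub_ne_zero]; intro h
    have := inv_lt_one_of_one_lt₀ h1
    linarith
  field_simp

theorem mul_exp_half_le_exp_sub_one {θ : ℝ} (hθ : 0 ≤ θ) :
    θ * Real.exp (θ / 2) ≤ Real.exp θ - 1 := by
  have h := Real.self_le_sinh_iff.2 (show 0 ≤ θ / 2 by linarith)
  rw [Real.sinh_eq] at h
  have h' := mul_le_mul_of_nonneg_right h (Real.exp_pos (θ / 2)).le
  have e1 : Real.exp (θ / 2) * Real.exp (θ / 2) = Real.exp θ := by
    rw [← Real.exp_add]; congr 1; ring
  have e2 : Real.exp (-(θ / 2)) * Real.exp (θ / 2) = 1 := by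
    rw [← Real.exp_add, neg_add_cancel, Real.exp_zero]
  nlinarith

theorem sub_one_sub_log_le {θ v : ℝ} (hθ : θ ≤ 2 / 3) (h1 : 1 - θ / 2 ≤ v) (h2 : v ≤ 1 + θ / 2) :
    v - 1 - Real.log v ≤ θ / 8 := by
  have hθ0 : 0 ≤ θ := by linarith
  have hv : 0 < v := by linarith
  rcases le_total 1 v with h | h
  · have hl := Real.le_log_one_add_of_nonneg (x := v - 1) (by linarith)
    rw [show 1 + (v - 1) = v by ring, div_le_iff₀ (by linarith)] at hl
    nlinarith
  · have hl := Real.log_le_half_sub_inv (x := v⁻¹) ((one_le_inv₀ hv).2 h)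
    rw [Real.log_inv, inv_inv] at hl
    have : v⁻¹ * v = 1 := inv_mul_cancel₀ hv.ne'
    have h3 : v * (v - 1 - Real.log v) ≤ (v - 1) ^ 2 / 2 := by nlinarith
    have h4 : (v - 1) ^ 2 ≤ (θ / 2) ^ 2 := by nlinarith
    have h5 : v * (θ / 8) ≥ (2 / 3) * (θ / 8) := by nlinarith
    by_contra hc
    push Not at hc
    nlinarith

theorem exp_add_exp_neg_le_one {θ : ℝ} (h1 : 2 / 3 ≤ θ) (h2 : θ ≤ 9 / 4) :
    Real.exp (3 / 8 * θ - 1) + Real.exp (-θ) ≤ 1 := by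
  have c1 : ConvexOn ℝ (Set.Icc (2 / 3 : ℝ) (9 / 4)) fun t => Real.exp (3 / 8 * t - 1) := by
    have := convexOn_exp.comp_affineMap
      ((3 / 8 : ℝ) • AffineMap.id ℝ ℝ - AffineMap.const ℝ ℝ (1 : ℝ))
    exact this.subset (Set.subset_univ _) (convex_Icc _ _)
  have c2 : ConvexOn ℝ (Set.Icc (2 / 3 : ℝ) (9 / 4)) fun t => Real.exp (-t) := by
    have := convexOn_exp.comp_affineMap (-AffineMap.id ℝ ℝ)
    exact this.subset (Set.subset_univ _) (convex_Icc _ _)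
  have hc := (c1.add c2).le_max_of_mem_Icc (Set.left_mem_Icc.2 (by norm_num))
    (Set.right_mem_Icc.2 (by norm_num)) ⟨h1, h2⟩
  refine hc.trans (max_le ?_ ?_)
  · have a1 := Real.sum_le_exp_of_nonneg (x := 3 / 4) (by norm_num) 5
    have a2 := Real.sum_le_exp_of_nonneg (x := 2 / 3) (by norm_num) 5
    simp only [Finset.sum_range_succ, Finset.sum_range_zero, Nat.factorial] at a1 a2
    norm_num at a1 a2
    simp only [Pi.add_apply]
    rw [show (3 / 8 * (2 / 3) - 1 : ℝ) = -(3 / 4) by norm_num, Real.exp_neg, Real.exp_neg]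
    have b1 := inv_anti₀ (by norm_num) a1
    have b2 := inv_anti₀ (by norm_num) a2
    refine (add_le_add b1 b2).trans ?_
    norm_num
  · have a1 := Real.sum_le_exp_of_nonneg (x := 5 / 32) (by norm_num) 3
    have a2 := Real.sum_le_exp_of_nonneg (x := 9 / 4) (by norm_num) 5
    simp only [Finset.sum_range_succ, Finset.sum_range_zero, Nat.factorial] at a1 a2
    norm_num at a1 a2
    simp only [Pi.add_apply]
    rw [show (3 / 8 * (9 / 4) - 1 : ℝ) = -(5 / 32) by norm_num, Real.exp_neg, Real.exp_neg]
    have b1 := inv_anti₀ (by norm_num) a1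
    have b2 := inv_anti₀ (by norm_num) a2
    refine (add_le_add b1 b2).trans ?_
    norm_num

/-- The number `z` of averaged levels is the integer nearest to `1/θ`; this is where the constant
`e` arises, as the minimum of `exp v / v`. -/
theorem exists_exp_mul_le {θ : ℝ} (h0 : 0 < θ) (h1 : θ ≤ 9 / 4) :
    ∃ z : ℕ, 0 < z ∧ (z = 1 ∨ (z : ℝ) ≤ 1 / θ + 1 / 2) ∧
      Real.exp (3 / 8 * θ) * (Real.exp (θ * z) / (Real.exp θ - 1)) ≤ z * Real.exp 1 := by
  have hE : 0 < Real.exp θ - 1 := by linarith [Real.one_lt_exp_iff.2 h0]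
  rcases le_total θ (2 / 3) with h | h
  · set z := ⌊1 / θ + 1 / 2⌋₊ with hz
    have hinv : 3 / 2 ≤ 1 / θ := by rw [le_div_iff₀ h0]; linarith
    have z1 : (z : ℝ) ≤ 1 / θ + 1 / 2 := Nat.floor_le (by linarith)
    have z2 : 1 / θ + 1 / 2 < z + 1 := Nat.lt_floor_add_one _
    have z0 : (0 : ℝ) < z := by linarith
    refine ⟨z, by exact_mod_cast z0, Or.inr z1, ?_⟩
    have m1 : θ * z ≤ 1 + θ / 2 := by
      have := mul_le_mul_of_nonneg_left z1 h0.le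
      rw [mul_add, mul_one_div_cancel h0.ne'] at this; linarith
    have m2 : 1 - θ / 2 ≤ θ * z := by
      have := mul_le_mul_of_nonneg_left z2.le h0.le
      rw [mul_add, mul_one_div_cancel h0.ne'] at this; linarith
    have hv := sub_one_sub_log_le h m2 m1
    have hv0 : 0 < θ * z := by positivity
    rw [mul_div_assoc', div_le_iff₀ hE, ← Real.exp_add]
    have h3 := mul_exp_half_le_exp_sub_one h0.le
    have h4 : Real.exp (3 / 8 * θ + θ * z) ≤ Real.exp 1 * (θ * z) * Real.exp (θ / 2) := by
      rw [← Real.exp_log hv0, ← Real.exp_add, ← Real.exp_add, Real.exp_log hv0]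
      exact Real.exp_le_exp.2 (by linarith)
    refine h4.trans ?_
    have := mul_le_mul_of_nonneg_left h3 (show 0 ≤ Real.exp 1 * z by positivity)
    linarith
  · refine ⟨1, one_pos, Or.inl rfl, ?_⟩
    rw [mul_div_assoc', div_le_iff₀ hE, ← Real.exp_add]
    have := mul_le_mul_of_nonneg_left (exp_add_exp_neg_le_one h h1) (Real.exp_pos (1 + θ)).le
    rw [mul_add, ← Real.exp_add, ← Real.exp_add, mul_one, show 1 + θ + -θ = 1 by ring,
      show 1 + θ + (3 / 8 * θ - 1) = 3 / 8 * θ + θ * (1 : ℕ) by push_cast; ring,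
      Real.exp_add 1 θ] at this
    push_cast at this ⊢
    linarith

/-- The averaged bound for identically distributed points. For `c ≥ N / 2` a single level
suffices. The hypothesis `N ≤ 2 * c ^ 2` excludes only cases in which the right-hand side exceeds
`1`; it makes `c ≥ 1`, as the choice of `z` requires. -/
theorem exists_average_le {N : ℕ} (hN : 2 ≤ N) {c : ℝ} (hc : 0 < c) (hcN : c < N)
    (hc2 : (N : ℝ) ≤ 2 * c ^ 2) {B : ℝ → ℝ}
    (hB : ∀ y : ℝ, 1 ≤ y → y < N →
      B y ≤ Real.exp (-(2 * y * (y - 1) / N - 1 / 2 * Real.log (1 - y / N))))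
    (hB0 : ∀ y : ℝ, (N : ℝ) ≤ y → B y ≤ 0) :
    ∃ z : ℕ, 0 < z ∧ (z : ℝ) ≤ c ∧ 1 / z * ∑ i ∈ Finset.range N, B (c - z + (i + 1)) ≤
      Real.exp 1 * Real.exp (-(2 * c ^ 2 / N)) := by
  have hN2 : (2 : ℝ) ≤ N := by exact_mod_cast hN
  have hN' : (0 : ℝ) < N := by linarith
  have hc1 : 1 ≤ c := by nlinarith
  have hlog : ∀ y : ℝ, y < N → 0 < 1 - y / N := fun y hy => by
    rw [sub_pos, div_lt_one hN']; exact hy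
  have hint : ∀ k : ℤ, (k : ℝ) ≤ (k : ℝ) ^ 2 := fun k => by exact_mod_cast Int.le_self_sq k
  rcases lt_or_ge c (N / 2) with hcase | hcase
  · set θ := (4 * c + 1 / 2) / N with hθ
    have hθ0 : 0 < θ := by positivity
    have hθ1 : θ ≤ 9 / 4 := by rw [hθ, div_le_iff₀ hN']; linarith
    obtain ⟨z, hz0, hz1, hz⟩ := exists_exp_mul_le hθ0 hθ1
    have hzpos : (0 : ℝ) < z := by exact_mod_cast hz0
    have hzc : (z : ℝ) ≤ c := by
      rcases hz1 with rfl | hz1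
      · simpa using hc1
      · have : 1 / θ ≤ c / 2 := by
          rw [hθ, one_div_div, div_le_iff₀ (by positivity)]; nlinarith
        linarith
    refine ⟨z, hz0, hzc, ?_⟩
    have hterm : ∀ i : ℕ, B (c - z + (i + 1)) ≤ Real.exp (-(2 * c ^ 2 / N)) *
        (Real.exp (3 / 8 * θ) * Real.exp (-θ * ((i : ℝ) + 1 - z))) := by
      intro i
      rcases lt_or_ge (c - z + (i + 1)) N with hy | hy
      · have hi : (0 : ℝ) ≤ i := i.cast_nonneg
        refine (hB _ (by linarith) hy).trans ?_
        rw [← Real.exp_add, ← Real.exp_add]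
        refine Real.exp_le_exp.2 ?_
        have hl := Real.log_le_sub_one_of_pos (hlog _ hy)
        have hk := hint ((i : ℤ) + 1 - z)
        push_cast at hk
        set k : ℝ := (i : ℝ) + 1 - z with hkdef
        rw [show c - z + ((i : ℝ) + 1) = c + k by rw [hkdef]; ring] at hl ⊢
        have e : -(2 * c ^ 2 / N) + (3 / 8 * θ + -θ * k) -
            (-(2 * (c + k) * (c + k - 1) / N) + 1 / 2 * (1 - (c + k) / N - 1)) =
            (2 * (k ^ 2 - k) + 3 / 16) / N := by
          rw [hθ]; field_simp; ring
        have : 0 ≤ (2 * (k ^ 2 - k) + 3 / 16) / N := div_nonneg (by linarith) hN'.le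
        linarith
      · exact (hB0 _ hy).trans (by positivity)
    calc _ ≤ 1 / z * ∑ i ∈ Finset.range N, Real.exp (-(2 * c ^ 2 / N)) *
          (Real.exp (3 / 8 * θ) * Real.exp (-θ * ((i : ℝ) + 1 - z))) :=
          mul_le_mul_of_nonneg_left (Finset.sum_le_sum fun i _ => hterm i) (by positivity)
      _ = 1 / z * (Real.exp (-(2 * c ^ 2 / N)) * (Real.exp (3 / 8 * θ) *
          ∑ i ∈ Finset.range N, Real.exp (-θ * ((i : ℝ) + 1 - z)))) := by
          rw [← Finset.mul_sum, ← Finset.mul_sum]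
      _ ≤ 1 / z * (Real.exp (-(2 * c ^ 2 / N)) * (z * Real.exp 1)) := by
          refine mul_le_mul_of_nonneg_left (mul_le_mul_of_nonneg_left (le_trans ?_ hz)
            (Real.exp_pos _).le) (by positivity)
          exact mul_le_mul_of_nonneg_left (sum_exp_shift_le hθ0 N z) (Real.exp_pos _).le
      _ = _ := by field_simp
  · set δ := c / N with hδ
    have hδ0 : 1 / 2 ≤ δ := by rw [hδ, le_div_iff₀ hN']; linarith
    have hδ1 : 0 < 1 - δ := hlog c hcN
    refine ⟨1, one_pos, by simpa using hc1, ?_⟩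
    have hterm : ∀ i : ℕ, B (c - (1 : ℕ) + (i + 1)) ≤
        Real.exp (-(2 * c ^ 2 / N)) * (Real.exp (3 / 2) / 2) * Real.exp (-2 * i) := by
      intro i
      have hi : (0 : ℝ) ≤ i := i.cast_nonneg
      have ei : c - (1 : ℕ) + ((i : ℝ) + 1) = c + i := by push_cast; ring
      rw [ei]
      rcases lt_or_ge (c + i) N with hy | hy
      · refine (hB _ (by linarith) hy).trans ?_
        have h2 : Real.exp (3 / 2) / 2 = Real.exp (3 / 2 - Real.log 2) := by
          rw [Real.exp_sub, Real.exp_log (by norm_num)]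
        rw [h2, ← Real.exp_add, ← Real.exp_add]
        refine Real.exp_le_exp.2 ?_
        have hl : Real.log (1 - (c + i) / N) ≤ Real.log (1 - δ) := by
          refine Real.log_le_log (hlog _ hy) ?_
          rw [hδ, add_div]
          linarith [show 0 ≤ (i : ℝ) / N by positivity]
        -- the tangent of the logarithm at `1/4`, where `2 δ + log (1 - δ) / 2` is largest
        have hl2 : Real.log (1 - δ) ≤ 4 * (1 - δ) - 1 - 2 * Real.log 2 := by
          have := Real.log_le_sub_one_of_pos (show 0 < 4 * (1 - δ) by linarith)
          rw [Real.log_mul (by norm_num) hδ1.ne', show (4 : ℝ) = 2 ^ 2 by norm_num,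
            Real.log_pow] at this
          push_cast at this
          norm_num at this ⊢
          linarith
        have hk := hint (i : ℤ)
        push_cast at hk
        have e : -(2 * (c + i) * (c + i - 1) / N) =
            -(2 * c ^ 2 / N) + 2 * δ - 4 * δ * i - 2 * ((i : ℝ) ^ 2 - i) / N := by
          rw [hδ]; field_simp; ring
        have : 0 ≤ 2 * ((i : ℝ) ^ 2 - i) / N := div_nonneg (by linarith) hN'.le
        have : 2 * (i : ℝ) ≤ 4 * δ * i := by nlinarith
        linarith
      · exact (hB0 _ hy).trans (by positivity)
    have hnum : Real.exp (3 / 2) / 2 * (1 - Real.exp (-2))⁻¹ ≤ Real.exp 1 := by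
      have h1 : Real.exp (3 / 2) = Real.exp 1 * Real.exp (1 / 2) := by
        rw [← Real.exp_add]; norm_num
      have h2 : Real.exp (1 / 2) ≤ 1.7 := by
        have : Real.exp (1 / 2) ^ 2 = Real.exp 1 := by
          rw [← Real.exp_nat_mul]; norm_num
        nlinarith [Real.exp_one_lt_d9, Real.exp_pos (1 / 2 : ℝ)]
      have h3 : Real.exp (-2) ≤ 0.15 := by
        have : Real.exp (-1) ^ 2 = Real.exp (-2) := by
          rw [← Real.exp_nat_mul]; norm_num
        nlinarith [Real.exp_neg_one_lt_d9, Real.exp_pos (-1 : ℝ)]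
      rw [← div_eq_mul_inv, div_le_iff₀ (by linarith), h1]
      nlinarith [Real.exp_pos 1]
    calc _ ≤ 1 / ((1 : ℕ) : ℝ) * ∑ i ∈ Finset.range N,
          Real.exp (-(2 * c ^ 2 / N)) * (Real.exp (3 / 2) / 2) * Real.exp (-2 * i) :=
          mul_le_mul_of_nonneg_left (Finset.sum_le_sum fun i _ => hterm i) (by positivity)
      _ = Real.exp (-(2 * c ^ 2 / N)) * (Real.exp (3 / 2) / 2 *
          ∑ i ∈ Finset.range N, Real.exp (-2 * i)) := by
          rw [← Finset.mul_sum]; push_cast; ring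
      _ ≤ Real.exp (-(2 * c ^ 2 / N)) * Real.exp 1 := by
          refine mul_le_mul_of_nonneg_left (le_trans ?_ hnum) (Real.exp_pos _).le
          exact mul_le_mul_of_nonneg_left (sum_exp_neg_le (by norm_num) N) (by positivity)
      _ = _ := mul_comm _ _

/-! ### The finite bound -/

open Classical in
/-- For a single variable, two additional points suffice. -/
theorem crossingWeight_one_le {M : ℕ} {q : Fin M → ℝ} (hq : ∀ l, 0 ≤ q l)
    (hq1 : ∑ l, q l = 1) {c : ℝ} (hc : 0 < c) (hc1 : c < 1) (hc2 : 1 ≤ 2 * c ^ 2) :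
    crossingWeight 1 q c ≤ Real.exp 1 * Real.exp (-(2 * c ^ 2)) := by
  have hle : crossingWeight 1 q c ≤ 1 / (3 * c ^ 2) := by
    refine crossingWeight_le_of_weights one_pos hq hq1 hc {2} (fun _ => 1) (by simp) (by simp)
      (by positivity) fun n A hA hA1 hnA => ?_
    push_cast at hnA
    have hn : n = 0 := by
      by_contra h
      have : (1 : ℝ) ≤ n := by exact_mod_cast Nat.one_le_iff_ne_zero.2 h
      linarith
    subst hn
    have e := pow_mul_exp_logGain one_pos 0 2 hA
    rw [pow_zero, one_mul] at e
    rw [Finset.sum_singleton, e, tiltKernel]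
    simp only [Nat.factorial]
    push_cast at hnA ⊢
    rw [one_div, inv_mul_eq_div, le_div_iff₀ (by positivity)]
    norm_num
    nlinarith
  refine hle.trans ?_
  rw [← Real.exp_add, div_le_iff₀ (by positivity)]
  -- the chord of the convex function `exp` on `[0, 1]`
  have hchord : Real.exp (2 * c ^ 2 - 1) ≤ 3 * c ^ 2 := by
    have h0 : 0 ≤ 2 * c ^ 2 - 1 := by linarith
    have h1 : 0 ≤ 2 - 2 * c ^ 2 := by nlinarith
    have := convexOn_exp.2 (Set.mem_univ 0) (Set.mem_univ 1) h1 h0 (by ring)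
    simp only [smul_eq_mul, mul_zero, mul_one, zero_add, Real.exp_zero] at this
    nlinarith [Real.exp_one_lt_d9]
  have e : Real.exp (1 + -(2 * c ^ 2)) = (Real.exp (2 * c ^ 2 - 1))⁻¹ := by
    rw [← Real.exp_neg]; congr 1; ring
  rw [e, inv_mul_eq_div, le_div_iff₀ (Real.exp_pos _), one_mul]
  exact hchord

open Classical in
theorem sum_crossing_le {M N : ℕ} (hN : 0 < N) {p : Fin N → Fin M → ℝ}
    (hp : ∀ i l, 0 ≤ p i l) (hp1 : ∀ i, ∑ l, p i l = 1) {c : ℝ} (hc : 0 < c) (hcN : c < N)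
    (hc2 : (N : ℝ) ≤ 2 * c ^ 2) :
    ∑ x : Fin N → Fin M, (∏ i, p i (x i)) *
      (if ∃ l, ∑ i, cumWeight (p i) l + c ≤ levelCount x l then 1 else 0) ≤
      Real.exp 1 * Real.exp (-(2 * c ^ 2 / N)) := by
  have hN' : (0 : ℝ) < N := by exact_mod_cast hN
  rcases Nat.lt_or_ge N 2 with h | h
  · obtain rfl : N = 1 := by omega
    push_cast at hcN hc2 ⊢
    have := crossingWeight_one_le (hp 0) (hp1 0) hc hcN hc2
    simpa [crossingWeight] using this
  · set q : Fin M → ℝ := fun l => (∑ r, p r l) / N with hq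
    have hq0 : ∀ l, 0 ≤ q l := fun l => div_nonneg (Finset.sum_nonneg fun i _ => hp i l) hN'.le
    have hq1 : ∑ l, q l = 1 := by
      rw [hq, ← Finset.sum_div, Finset.sum_comm]
      simp [hp1, hN'.ne']
    obtain ⟨z, hz, hzc, hle⟩ := exists_average_le h hc hcN hc2 (B := crossingWeight N q)
      (fun y hy hyN => crossingWeight_le hq0 hq1 hy hyN)
      (fun y hy => (crossingWeight_eq_zero hN hq0 hy).le)
    exact (sum_crossing_le_sum_crossingWeight hN hp hp1 hz hzc).trans hle

/-! ### Reduction to finitely many levels -/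

/-- The number of points of the grid `T` to the left of `x`; it indexes the cell of the grid that
contains `x`. -/
noncomputable def gridCell (T : Finset ℝ) (x : ℝ) : Fin (T.card + 1) :=
  ⟨(T.filter (· < x)).card, Nat.lt_succ_of_le (Finset.card_filter_le _ _)⟩

theorem gridCell_le_iff {T : Finset ℝ} {t : ℝ} (ht : t ∈ T) (x : ℝ) :
    gridCell T x ≤ gridCell T t ↔ x ≤ t := by
  rw [gridCell, gridCell, Fin.mk_le_mk]
  constructor
  · intro h
    by_contra! hx
    refine absurd h (not_le.2 (Finset.card_lt_card ⟨?_, fun hs => ?_⟩))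
    · exact Finset.monotone_filter_right T fun s _ hs => lt_trans hs hx
    · have := hs (Finset.mem_filter.2 ⟨ht, hx⟩)
      exact lt_irrefl _ (Finset.mem_filter.1 this).2
  · exact fun h => Finset.card_le_card (Finset.monotone_filter_right T fun s _ hs => hs.trans_le h)

theorem measurable_gridCell (T : Finset ℝ) : Measurable (gridCell T) := by
  have hm : Measurable fun x : ℝ => (T.filter (· < x)).card := by
    simp only [Finset.card_filter]
    exact Finset.measurable_fun_sum T fun s _ =>
      Measurable.ite measurableSet_Ioi measurable_const measurable_const
  refine measurable_to_countable' fun k => ?_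
  have : gridCell T ⁻¹' {k} = (fun x : ℝ => (T.filter (· < x)).card) ⁻¹' {(k : ℕ)} := by
    ext x; simp [gridCell, Fin.ext_iff]
  rw [this]
  exact hm (measurableSet_singleton _)

section

variable {Ω : Type*} [MeasurableSpace Ω] {μ : Measure Ω} [IsProbabilityMeasure μ] {N : ℕ}
  {X : Fin N → Ω → ℝ}

/-- The cells up to that of the grid point `t` make up the half-line to the left of `t`. -/
theorem cumWeight_measureReal_gridCell {Z : Ω → ℝ} (hZ : Measurable Z) {T : Finset ℝ} {t : ℝ}
    (ht : t ∈ T) :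
    cumWeight (fun k => μ.real {ω | gridCell T (Z ω) = k}) (gridCell T t) =
      cdf (μ.map Z) t := by
  have := Measure.isProbabilityMeasure_map (μ := μ) hZ.aemeasurable
  have hm := (measurable_gridCell T).comp hZ
  rw [cdf_eq_real, map_measureReal_apply hZ measurableSet_Iic, cumWeight,
    ← measureReal_biUnion_finset]
  · congr 1
    ext ω
    simp [gridCell_le_iff ht]
  · intro k _ l _ hkl
    exact Set.disjoint_left.2 fun ω (h1 : _ = k) (h2 : _ = l) => hkl (h1.symm.trans h2)
  · exact fun k _ => hm (measurableSet_singleton k)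

theorem measureReal_exists_mem_finset_le (hN : 0 < N) (hX : ∀ i, Measurable (X i))
    (hindep : iIndepFun X μ) {c : ℝ} (hc : 0 < c) (hcN : c < N) (hc2 : (N : ℝ) ≤ 2 * c ^ 2)
    (T : Finset ℝ) :
    μ.real {ω | ∃ t ∈ T, ∑ i, cdf (μ.map (X i)) t + c <
      ∑ i, Set.indicator (Set.Iic t) (fun _ => (1 : ℝ)) (X i ω)} ≤
      Real.exp 1 * Real.exp (-(2 * c ^ 2 / N)) := by
  classical
  set Y : Fin N → Ω → Fin (T.card + 1) := fun i ω => gridCell T (X i ω) with hY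
  set p : Fin N → Fin (T.card + 1) → ℝ := fun i k => μ.real {ω | gridCell T (X i ω) = k} with hp
  have hYm : ∀ i, Measurable (Y i) := fun i => (measurable_gridCell T).comp (hX i)
  have hYi : iIndepFun Y μ := hindep.comp _ fun _ => measurable_gridCell T
  have hp1 : ∀ i, ∑ k, p i k = 1 := by
    intro i
    have := sum_measureReal_preimage_singleton (μ := μ) (f := Y i) Finset.univ
      fun k _ => hYm i (measurableSet_singleton k)
    rw [Finset.coe_univ, Set.preimage_univ, probReal_univ] at this
    exact this
  have hprod : ∀ x : Fin N → Fin (T.card + 1), μ.real {ω | ∀ i, Y i ω = x i} =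
      ∏ i, p i (x i) := by
    intro x
    have := hYi.measure_inter_preimage_eq_mul Finset.univ (sets := fun i => {x i})
      fun i _ => measurableSet_singleton _
    have e : {ω | ∀ i, Y i ω = x i} = ⋂ i ∈ Finset.univ, Y i ⁻¹' {x i} := by ext; simp
    rw [measureReal_def, e, this, ENNReal.toReal_prod]
    rfl
  set P : (Fin N → Fin (T.card + 1)) → Prop :=
    fun x => ∃ l, ∑ i, cumWeight (p i) l + c ≤ levelCount x l with hP
  calc _ ≤ μ.real (⋃ x ∈ Finset.univ.filter P, {ω | ∀ i, Y i ω = x i}) := by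
        refine measureReal_mono (fun ω hω => ?_) (measure_ne_top _ _)
        obtain ⟨t, ht, h⟩ := hω
        simp only [Set.mem_iUnion, Finset.mem_filter, Finset.mem_univ, true_and]
        refine ⟨fun i => Y i ω, ⟨gridCell T t, ?_⟩, fun i => rfl⟩
        have h1 : ∑ i, cumWeight (p i) (gridCell T t) = ∑ i, cdf (μ.map (X i)) t :=
          Finset.sum_congr rfl fun i _ => cumWeight_measureReal_gridCell (hX i) ht
        have h2 : ∑ i, Set.indicator (Set.Iic t) (fun _ => (1 : ℝ)) (X i ω) =
            levelCount (fun i => Y i ω) (gridCell T t) := by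
          simp [levelCount, hY, gridCell_le_iff ht, Set.indicator_apply]
        rw [h1, ← h2]
        exact h.le
    _ ≤ ∑ x ∈ Finset.univ.filter P, μ.real {ω | ∀ i, Y i ω = x i} :=
        measureReal_biUnion_finset_le _ _
    _ = ∑ x, (∏ i, p i (x i)) * (if P x then 1 else 0) := by
        rw [Finset.sum_filter]
        exact Finset.sum_congr rfl fun x _ => by rw [hprod]; split_ifs <;> simp
    _ ≤ _ := sum_crossing_le hN (fun i k => measureReal_nonneg) hp1 hc hcN hc2

theorem measureReal_exists_le (hN : 0 < N) (hX : ∀ i, Measurable (X i))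
    (hindep : iIndepFun X μ) {c : ℝ} (hc : 0 < c) (hcN : c < N) (hc2 : (N : ℝ) ≤ 2 * c ^ 2) :
    μ.real {ω | ∃ t, ∑ i, cdf (μ.map (X i)) t + c <
      ∑ i, Set.indicator (Set.Iic t) (fun _ => (1 : ℝ)) (X i ω)} ≤
      Real.exp 1 * Real.exp (-(2 * c ^ 2 / N)) := by
  classical
  set E : Finset ℝ → Set Ω := fun T => {ω | ∃ t ∈ T, ∑ i, cdf (μ.map (X i)) t + c <
      ∑ i, Set.indicator (Set.Iic t) (fun _ => (1 : ℝ)) (X i ω)} with hE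
  set φ : Finset ℚ → Finset ℝ := fun T => T.image ((↑) : ℚ → ℝ) with hφ
  have hsub : {ω | ∃ t, ∑ i, cdf (μ.map (X i)) t + c <
      ∑ i, Set.indicator (Set.Iic t) (fun _ => (1 : ℝ)) (X i ω)} ⊆ ⋃ T, E (φ T) := by
    rintro ω ⟨t, ht⟩
    -- by right continuity of the distribution functions, `t` may be moved to a rational number
    have hcont : ContinuousWithinAt (fun s => ∑ i, cdf (μ.map (X i)) s + c) (Set.Ioi t) t := by
      refine ContinuousWithinAt.add ?_ continuousWithinAt_const
      exact tendsto_finsetSum _ fun i _ =>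
        ((cdf (μ.map (X i))).right_continuous t).mono Set.Ioi_subset_Ici_self
    have hev := hcont.eventually_lt_const ht
    obtain ⟨u, hu, hIoo⟩ := mem_nhdsGT_iff_exists_Ioo_subset.1 hev
    obtain ⟨s, hs1, hs2⟩ := exists_rat_btwn (Set.mem_Ioi.1 hu)
    refine Set.mem_iUnion.2 ⟨{s}, s, by simp [hφ], ?_⟩
    refine lt_of_lt_of_le (hIoo ⟨hs1, hs2⟩) (Finset.sum_le_sum fun i _ => ?_)
    exact Set.indicator_le_indicator_of_subset (Set.Iic_subset_Iic.2 hs1.le)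
      (fun _ => zero_le_one) _
  have hdir : Directed (· ⊆ ·) fun T => E (φ T) := by
    refine Monotone.directed_le (f := fun T => E (φ T)) fun S T hST ω hω => ?_
    obtain ⟨t, ht, h⟩ := hω
    exact ⟨t, Finset.image_subset_image hST ht, h⟩
  refine (measureReal_mono hsub).trans ?_
  refine ENNReal.toReal_le_of_le_ofReal (by positivity) ?_
  rw [hdir.measure_iUnion]
  refine iSup_le fun T => ?_
  rw [← ENNReal.ofReal_toReal (measure_ne_top μ (E (φ T)))]
  exact ENNReal.ofReal_le_ofReal
    (measureReal_exists_mem_finset_le hN hX hindep hc hcN hc2 (φ T))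

end

theorem mainTheorem4 {Ω : Type*} [MeasurableSpace Ω] (μ : Measure Ω) [IsProbabilityMeasure μ]
    (N : ℕ) (hN : 1 ≤ N)
    (X : Fin N → Ω → ℝ) (hX : ∀ i, Measurable (X i)) (hindep : iIndepFun X μ)
    (K : Fin N → ℝ → ℝ) (hK : ∀ i x, cdf (μ.map (X i)) x ≤ K i x)
    (lam : ℝ) (hlam : 0 ≤ lam) :
    μ.real {ω | Real.sqrt N * (⨆ t : ℝ, (empiricalCDF (fun i => X i ω) t - meanFun K t)) > lam}
      ≤ Real.exp 1 * Real.exp (-2 * lam ^ 2) := by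
  have hN' : (0 : ℝ) < N := by exact_mod_cast hN
  have hsq : 0 < Real.sqrt N := Real.sqrt_pos.2 hN'
  have hss : Real.sqrt N * Real.sqrt N = N := Real.mul_self_sqrt hN'.le
  set c := lam * Real.sqrt N with hc
  have hc2 : c ^ 2 = lam ^ 2 * N := by rw [hc, mul_pow, Real.sq_sqrt hN'.le]
  have hsub : {ω | Real.sqrt N * (⨆ t : ℝ, (empiricalCDF (fun i => X i ω) t - meanFun K t)) > lam}
      ⊆ {ω | ∃ t, ∑ i, cdf (μ.map (X i)) t + c <
        ∑ i, Set.indicator (Set.Iic t) (fun _ => (1 : ℝ)) (X i ω)} := by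
    intro ω hω
    have h1 : lam / Real.sqrt N < ⨆ t : ℝ, (empiricalCDF (fun i => X i ω) t - meanFun K t) := by
      rw [div_lt_iff₀' hsq]; exact hω
    obtain ⟨t, ht⟩ := exists_lt_of_lt_ciSup h1
    refine ⟨t, ?_⟩
    rw [empiricalCDF, meanFun, ← mul_sub, one_div, inv_mul_eq_div,
      div_lt_div_iff₀ hsq hN'] at ht
    have h2 : ∑ i, cdf (μ.map (X i)) t ≤ ∑ i, K i t := Finset.sum_le_sum fun i _ => hK i t
    have h3 : c < ∑ i, Set.indicator (Set.Iic t) (fun _ => (1 : ℝ)) (X i ω) - ∑ i, K i t := by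
      refine lt_of_mul_lt_mul_right ?_ hsq.le
      rw [hc, mul_assoc, hss]
      exact ht
    linarith
  refine (measureReal_mono hsub).trans ?_
  rcases le_or_gt (2 * lam ^ 2) 1 with hsmall | hbig
  · refine measureReal_le_one.trans ?_
    rw [← Real.exp_add]
    exact Real.one_le_exp (by linarith)
  · have hlam0 : 0 < lam := lt_of_le_of_ne hlam fun h => by rw [← h] at hbig; norm_num at hbig
    rcases lt_or_ge c N with hcN | hcN
    · refine (measureReal_exists_le hN hX hindep (mul_pos hlam0 hsq) hcN ?_).trans (le_of_eq ?_)
      · rw [← hc, hc2]; nlinarith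
      · rw [← hc, hc2]; congr 2; field_simp
    · -- the empirical distribution function exceeds its mean by at most `1`
      have hempty : {ω | ∃ t, ∑ i, cdf (μ.map (X i)) t + c <
          ∑ i, Set.indicator (Set.Iic t) (fun _ => (1 : ℝ)) (X i ω)} = ∅ := by
        refine Set.eq_empty_of_forall_notMem fun ω ⟨t, ht⟩ => ?_
        have h1 : 0 ≤ ∑ i, cdf (μ.map (X i)) t := Finset.sum_nonneg fun i _ => cdf_nonneg _ t
        have h2 : ∑ i, Set.indicator (Set.Iic t) (fun _ => (1 : ℝ)) (X i ω) ≤ ∑ i : Fin N, 1 :=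
          Finset.sum_le_sum fun i _ => Set.indicator_le_self' (fun _ _ => zero_le_one) _
        simp at h2
        linarith
      rw [hempty, measureReal_empty]
      positivity
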